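/- **Setting.** Let $(\Omega,\mathcal F)$ be a measurable space and $\mathscr H$ a linear space of $\mathcal F$-measurable real functions on $\Omega$ such that $\varphi(Y_1,\dots,Y_n)\in\mathscr H$ whenever $Y_1,\dots,Y_n\in\mathscr H$ and $\varphi:\mathbb R^n\to\mathbb R$ satisfies $|\varphi(x)-\varphi(y)|\le C(1+|x|^m+|y|^m)|x-y|$ for some $C>0$, $m\in\mathbb N$. Let $\hat{\mathbb E}:\mathscr H\to[-\infty,\infty]$ be a sub-linear expectation: it is monotone, $\hat{\mathbb E}[c]=c$ for constants $c$, $\hat{\mathbb E}[X+Y]\le\hat{\mathbb E}[X]+\hat{\mathbb E}[Y]$ whenever the right side is not of the form $\infty-\infty$ or $-\infty+\infty$, and $\hat{\mathbb E}[\lambda X]=\lambda\hat{\mathbb E}[X]$ for $\lambda\ge0$. Let $\mathscr H_b$ be the set of bounded elements of $\mathscr H$, and put $$\widehat{\mathbb V}(A)=\inf\{\hat{\mathbb E}[\xi]: I_A\le\xi,\ \xi\in\mathscr H\},\qquad \widehat{\mathbb V}^*(A)=\inf\Big\{\sum_{n=1}^\infty\widehat{\mathbb V}(A_n): A\subset\bigcup_{n=1}^\infty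 A_n,\ A_n\in\mathcal F\Big\}.$$ Condition (CC): $\mathscr P$ is a family of probability measures on $(\Omega,\sigma(\mathscr H))$ such that $\hat{\mathbb E}[X]=\sup_{P\in\mathscr P}E_P[X]$ for all $X\in\mathscr H_b$, and such that for all $Y_1,Y_2,\dots\in\mathscr H_b$ the family of laws of $(Y_1,Y_2,\dots)$ on $\mathbb R^{\mathbb N}$ under the $P\in\mathscr P$ is weakly compact. Let $X_1,X_2,\dots\in\mathscr H$ be i.i.d. under $\hat{\mathbb E}$, that is, for all bounded Lipschitz $\varphi$: $\hat{\mathbb E}[\varphi(X_i)]=\hat{\mathbb E}[\varphi(X_1)]$, and $\hat{\mathbb E}[\varphi(X_1,\dots,X_{i+1})]=\hat{\mathbb E}\big[\hat{\mathbb E}[\varphi(x_1,\dots,x_i,X_{i+1})]\big|_{x_1=X_1,\dots,x_i=X_i}\big]$ for every $i\ge1$. Assume that the Choquet integral $C_{\widehat{\mathbb V}}(|X_1|)=\int_0^\infty\widehat{\mathbb V}(|X_1|\ge t)\,dt$ is finite. Put $\boldsymbol X=(X_1,X_2,\dots)$, $S_n=X_1+\dots+X_n$, $\overline\mu=\lim_{c\to\infty}\hat{\mathbb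 E}[(-c)\vee X_1\wedge c]$ and $\underline\mu=-\lim_{c\to\infty}\hat{\mathbb E}[(-c)\vee(-X_1)\wedge c]$, and let $C\{x_n\}$ denote the cluster set in $\mathbb R$ of a real sequence $(x_n)$. Let $\mathbb L_c$ be the set of Borel functions $\varphi:\mathbb R^{\mathbb N}\to\mathbb R$ such that for every $\epsilon>0$ there is a bounded continuous $\psi:\mathbb R^{\mathbb N}\to\mathbb R$ with $\sup_{P\in\mathscr P}E_P[|\varphi(\boldsymbol X)-\psi(\boldsymbol X)|]\le\epsilon$. **Theorem.** Under condition (CC): (a) For all $d$ and all Borel functions $\underline\varphi,\overline\varphi:\mathbb R^d\to\mathbb R$ with $\underline\mu\le\underline\varphi\le\overline\varphi\le\overline\mu$ everywhere, there is a probability measure $Q$ on $(\Omega,\sigma(\mathscr H))$ such that $E_Q[X]\le\hat{\mathbb E}[X]$ for all $X\in\mathscr H_b$ and $$\widehat{\mathbb V}^*\Big(C\Big\{\frac{S_n}n\Big\}=\big[\underline\varphi(X_1,\dots,X_d),\overline\varphi(X_1,\dots,X_d)\big]\Big)=Q\Big(C\Big\{\frac{S_n}n\Big\}=\big[\underline\varphi(X_1,\dots,X_d),\overline\varphi(X_1,\dots,X_d)\big]\Big)=1.$$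 (b) For all $\underline\varphi,\overline\varphi\in\mathbb L_c$ with $\underline\mu\le\underline\varphi\le\overline\varphi\le\overline\mu$ everywhere, there is $P\in\mathscr P$ such that $$\widehat{\mathbb V}^*\Big(C\Big\{\frac{S_n}n\Big\}=\big[\underline\varphi(\boldsymbol X),\overline\varphi(\boldsymbol X)\big]\Big)=P\Big(C\Big\{\frac{S_n}n\Big\}=\big[\underline\varphi(\boldsymbol X),\overline\varphi(\boldsymbol X)\big]\Big)=1.$$ -/

import Mathlib

open MeasureTheory Filter Topology
open scoped ENNReal BoundedContinuousFunction

/-- The class `C_{l,Lip}(ℝⁿ)` of locally Lipschitz functions of polynomial growth. -/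
def IsLocLip {n : ℕ} (φ : (Fin n → ℝ) → ℝ) : Prop :=
  ∃ C : ℝ, 0 < C ∧ ∃ m : ℕ, ∀ x y : Fin n → ℝ,
    |φ x - φ y| ≤ C * (1 + ‖x‖ ^ m + ‖y‖ ^ m) * ‖x - y‖

/-- Bounded Lipschitz functions; for `α = ℝⁿ` this is `C_{b,Lip}(ℝⁿ)`. -/
def IsBddLip {α : Type*} [PseudoMetricSpace α] (φ : α → ℝ) : Prop :=
  (∃ K, LipschitzWith K φ) ∧ ∃ M : ℝ, ∀ x, |φ x| ≤ M

/-- A sub-linear expectation space `(Ω, H, E)` over a measurable space `(Ω, 𝓕)`.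
The expectation is a function on `H`: it is represented by a function on all of `Ω → ℝ` whose
values outside `H` are irrelevant (no axiom and no definition below reads them). -/
structure SublinearExpectation (Ω : Type*) [MeasurableSpace Ω] where
  /-- the linear space of random variables -/
  H : Submodule ℝ (Ω → ℝ)
  measurable_of_mem : ∀ X ∈ H, Measurable X
  comp_mem : ∀ (n : ℕ) (φ : (Fin n → ℝ) → ℝ), IsLocLip φ →
    ∀ X : Fin n → Ω → ℝ, (∀ i, X i ∈ H) → (fun ω => φ (fun i => X i ω)) ∈ H
  /-- the sub-linear expectation -/
  E : (Ω → ℝ) → EReal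
  mono : ∀ X ∈ H, ∀ Y ∈ H, (∀ ω, Y ω ≤ X ω) → E Y ≤ E X
  const : ∀ c : ℝ, E (fun _ => c) = (c : EReal)
  subadd : ∀ X ∈ H, ∀ Y ∈ H, ¬ (E X = ⊤ ∧ E Y = ⊥) → ¬ (E X = ⊥ ∧ E Y = ⊤) →
    E (fun ω => X ω + Y ω) ≤ E X + E Y
  pos_homog : ∀ X ∈ H, ∀ r : ℝ, 0 ≤ r → E (fun ω => r * X ω) = (r : EReal) * E X

namespace SublinearExpectation

variable {Ω : Type*} [MeasurableSpace Ω] (S : SublinearExpectation Ω)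

/-- `σ(H)`, the σ-algebra on `Ω` generated by the random variables in `H`. -/
abbrev sigma : MeasurableSpace Ω := ⨆ X ∈ S.H, MeasurableSpace.comap X (borel ℝ)

/-- `H_b`, the bounded elements of `H`. -/
def Hb : Set (Ω → ℝ) := {X | X ∈ S.H ∧ ∃ M : ℝ, ∀ ω, |X ω| ≤ M}

/-- Probability measures on `(Ω, σ(H))`. -/
abbrev Prob : Type _ := @ProbabilityMeasure Ω S.sigma

/-- The upper capacity `V(A) = inf {E[ξ] : 1_A ≤ ξ, ξ ∈ H}`. Every `ξ` that occurs is nonnegative,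
so `E[ξ] ≥ 0` and nothing is lost by taking values in `[0, ∞]`; moreover `V(A) ≤ E[1] = 1`. -/
noncomputable def upperCapacity (A : Set Ω) : ℝ≥0∞ :=
  ⨅ (ξ : Ω → ℝ) (_ : ξ ∈ S.H) (_ : ∀ ω, A.indicator (fun _ => (1 : ℝ)) ω ≤ ξ ω), (S.E ξ).toENNReal

/-- The countably sub-additive extension `V*` of the upper capacity. -/
noncomputable def outerCapacity (A : Set Ω) : ℝ≥0∞ :=
  ⨅ (B : ℕ → Set Ω) (_ : ∀ n, MeasurableSet (B n)) (_ : A ⊆ ⋃ n, B n), ∑' n, S.upperCapacity (B n)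

/-- The Choquet expectation
`C_V[X] = ∫_0^∞ V(X ≥ t) dt + ∫_{-∞}^0 (V(X ≥ t) - 1) dt` for the upper capacity `V ≤ 1`. -/
noncomputable def choquet (X : Ω → ℝ) : EReal :=
  ((∫⁻ t in Set.Ioi (0 : ℝ), S.upperCapacity {ω | t ≤ X ω} : ℝ≥0∞) : EReal)
    - ((∫⁻ t in Set.Iio (0 : ℝ), (1 - S.upperCapacity {ω | t ≤ X ω}) : ℝ≥0∞) : EReal)

/-- The extended upper mean `lim_{c → ∞} E[(-c) ∨ X ∧ c]`. -/
noncomputable def upperMean (X : Ω → ℝ) : EReal :=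
  limUnder atTop (fun c : ℝ => S.E (fun ω => max (-c) (min (X ω) c)))

/-- The conjugate of the extended upper mean. -/
noncomputable def lowerMean (X : Ω → ℝ) : EReal := -S.upperMean (fun ω => -X ω)

/-- `X` and `Y` are identically distributed. -/
def IdentDistrib (X Y : Ω → ℝ) : Prop :=
  ∀ φ : ℝ → ℝ, IsBddLip φ → S.E (fun ω => φ (X ω)) = S.E (fun ω => φ (Y ω))

/-- `Y` is independent to the random vector `X = (X₁, …, X_m)`:
`E[φ(X, Y)] = E[E[φ(x, Y)]|_{x = X}]`. The inner expectation, of a bounded variable, is finite. -/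
def IndepTo {m : ℕ} (Y : Ω → ℝ) (X : Fin m → Ω → ℝ) : Prop :=
  ∀ φ : (Fin m → ℝ) × ℝ → ℝ, IsBddLip φ →
    S.E (fun ω => φ (fun i => X i ω, Y ω)) =
      S.E (fun ω => (S.E (fun ω' => φ (fun i => X i ω, Y ω'))).toReal)

/-- A sequence `X 0, X 1, …` of i.i.d. random variables of the sub-linear expectation space. -/
structure IsIID (X : ℕ → Ω → ℝ) : Prop where
  mem : ∀ i, X i ∈ S.H
  identDistrib : ∀ i, S.IdentDistrib (X i) (X 0)
  indep : ∀ i, S.IndepTo (X (i + 1)) (fun j : Fin (i + 1) => X j)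

/-- The laws on `ℝ^ℕ` of the sequence `Y` under the members of `Ps`. -/
def laws (Ps : Set S.Prob) (Y : ℕ → Ω → ℝ) : Set (ProbabilityMeasure (ℕ → ℝ)) :=
  {ν | ∃ P ∈ Ps, ∀ A : Set (ℕ → ℝ), MeasurableSet A →
    (ν : Measure (ℕ → ℝ)) A = (P : @Measure Ω S.sigma) {ω | (fun i => Y i ω) ∈ A}}

/-- Condition (CC): on `H_b`, `E` is the upper expectation of the family `Ps`, which is
countable-dimensionally weakly compact. -/
structure ConditionCC (Ps : Set S.Prob) : Prop where
  eq_sup : ∀ X ∈ S.Hb,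
    S.E X = ⨆ P ∈ Ps, ((∫ ω, X ω ∂(P : @Measure Ω S.sigma) : ℝ) : EReal)
  compact : ∀ Y : ℕ → Ω → ℝ, (∀ i, Y i ∈ S.Hb) → IsCompact (S.laws Ps Y)

/-- The set of probability measures on `σ(H)` dominated by `E` on `H_b`. -/
def maxFamily : Set S.Prob :=
  {Q | ∀ X ∈ S.Hb, ((∫ ω, X ω ∂(Q : @Measure Ω S.sigma) : ℝ) : EReal) ≤ S.E X}

/-- The space `𝕃_c`: the Borel functions on `ℝ^ℕ` in the completion of `C_b(ℝ^ℕ)` under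
`φ ↦ sup_{P ∈ Ps} E_P[|φ(X₁, X₂, …)|]`. -/
def Lc (Ps : Set S.Prob) (X : ℕ → Ω → ℝ) : Set ((ℕ → ℝ) → ℝ) :=
  {φ | Measurable φ ∧ ∀ ε : ℝ≥0∞, 0 < ε → ∃ ψ : (ℕ → ℝ) →ᵇ ℝ,
    (⨆ P ∈ Ps, ∫⁻ ω, ENNReal.ofReal |φ (fun i => X i ω) - ψ (fun i => X i ω)|
      ∂(P : @Measure Ω S.sigma)) ≤ ε}

end SublinearExpectation

/-- The cluster set of a real sequence: the limits in `ℝ` of its subsequences. -/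
def clusterSet (x : ℕ → ℝ) : Set ℝ := {a | MapClusterPt a atTop x}

/-- The averages `S_n / n`, where `S_n` is the sum of the first `n` terms. -/
noncomputable def runningAverage (x : ℕ → ℝ) (n : ℕ) : ℝ := (∑ i ∈ Finset.range n, x i) / n

/-! The walk is prescribed on longer and longer blocks, and a single member of `Ps` is found that
honours all prescriptions in mean. Take blocks `[n k, n (k + 1))` with `(k + 1) * n k ≤ n (k + 1)`,
so that the average at the end of a late block is governed by that block. Let Lipschitz functions `f
k`, `f' k` of the coordinates before `n k` approximate the two endpoint functions, let `q` cluster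
at every point of `[0, 1]`, and on block `k` aim at the mean `f k + q k * (f' k - f k)`, clipped to
the interval between the extended means. Averages that follow these targets sweep exactly the
required interval; this is the deterministic `clusterSet_runningAverage_eq_Icc`.

Missing the target on block `k` costs a Lipschitz penalty with values in `[0, 1]`. For every past
there is a law `p` dominated by the distribution of `X 0`, with mean close to the target, whose
product measure gives the penalty expectation at most `(1 / 2) ^ k`; the starting time that this
requires is uniform over the targets (`exists_uniform_deviation_le`). By independence the sub-linear
expectation is an iterated one, and each inner expectation is at least the integral against any
dominated `p`. Hence `p` may be chosen separately for each past, with no measurable selection, and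
subtracting the penalty lowers the expectation by at most `(1 / 2) ^ k` (`ev_sub_penalty_ge`). So
finitely many penalties are cheap under some member of `Ps`, and weak compactness yields one `P` for
all of them (`exists_forall_integral_le`). The penalties are then summable, so they tend to `0`
almost surely under `P`.

The approximations must also converge almost surely under this `P`, which is not known in advance.
On `𝕃_c` the approximation is uniform over `Ps`. For Borel functions of `d` coordinates it converges
almost surely only for the law of the head `(X 0, …, X (d - 1))` under a reference `P₀`; an extra
penalty for leaving closed sets of convergence then forces the head under `P` into one of them, and
`P₀` itself shows that this penalty is affordable. Finally, `V` dominates every measure dominated by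
the expectation, so an event of probability one has outer capacity one. -/

/-! ### Bounded functions and Lipschitz functions of finitely many coordinates. -/

/-- Functions on `ℝ^ℕ` that are Lipschitz functions of the first `n` coordinates. -/
def IsCylLip (n : ℕ) (f : (ℕ → ℝ) → ℝ) : Prop :=
  ∃ K : ℝ, 0 ≤ K ∧ ∀ x y, |f x - f y| ≤ K * ∑ i ∈ Finset.range n, |x i - y i|

/-- Bounded real functions. -/
def IsBdd {α : Type*} (f : α → ℝ) : Prop := ∃ M : ℝ, ∀ x, |f x| ≤ M

namespace IsBdd

variable {α : Type*} {f g : α → ℝ}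

lemma add (hf : IsBdd f) (hg : IsBdd g) : IsBdd (fun x => f x + g x) := by
  obtain ⟨M, hM⟩ := hf
  obtain ⟨N, hN⟩ := hg
  exact ⟨M + N, fun x => (abs_add_le _ _).trans (add_le_add (hM x) (hN x))⟩

lemma neg (hf : IsBdd f) : IsBdd (fun x => -f x) := by
  obtain ⟨M, hM⟩ := hf
  exact ⟨M, fun x => by rw [abs_neg]; exact hM x⟩

lemma sub (hf : IsBdd f) (hg : IsBdd g) : IsBdd (fun x => f x - g x) := by
  simpa only [sub_eq_add_neg] using hf.add hg.neg

lemma const (c : ℝ) : IsBdd (fun _ : α => c) := ⟨|c|, fun _ => le_rfl⟩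

lemma of_mem_Icc {a b : ℝ} (h : ∀ x, f x ∈ Set.Icc a b) : IsBdd f :=
  ⟨max |a| |b|, fun x => abs_le_max_abs_abs (h x).1 (h x).2⟩

lemma sum {ι : Type*} (s : Finset ι) {f : ι → α → ℝ} (h : ∀ i ∈ s, IsBdd (f i)) :
    IsBdd (fun x => ∑ i ∈ s, f i x) := by
  classical
  induction s using Finset.induction_on with
  | empty => simpa using const 0
  | insert i s hi ih =>
    simp only [Finset.sum_insert hi]
    exact (h i (by simp)).add (ih fun j hj => h j (by simp [hj]))

lemma comp {β : Type*} (hf : IsBdd f) (u : β → α) : IsBdd (fun x => f (u x)) :=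
  hf.imp fun _ h x => h (u x)

end IsBdd

namespace IsCylLip

variable {n m : ℕ} {f g : (ℕ → ℝ) → ℝ}

lemma add (hf : IsCylLip n f) (hg : IsCylLip n g) : IsCylLip n (fun x => f x + g x) := by
  obtain ⟨K, hK0, hK⟩ := hf
  obtain ⟨L, hL0, hL⟩ := hg
  refine ⟨K + L, by positivity, fun x y => ?_⟩
  rw [add_mul, show f x + g x - (f y + g y) = (f x - f y) + (g x - g y) by ring]
  exact (abs_add_le _ _).trans (add_le_add (hK x y) (hL x y))

lemma comp_lipschitz (hf : IsCylLip n f) {h : ℝ → ℝ} {L : ℝ} (hL : 0 ≤ L)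
    (hh : ∀ a b, |h a - h b| ≤ L * |a - b|) : IsCylLip n (fun x => h (f x)) := by
  obtain ⟨K, hK0, hK⟩ := hf
  refine ⟨L * K, by positivity, fun x y => ?_⟩
  rw [mul_assoc]
  exact (hh _ _).trans (mul_le_mul_of_nonneg_left (hK x y) hL)

lemma const_mul (hf : IsCylLip n f) (c : ℝ) : IsCylLip n (fun x => c * f x) :=
  hf.comp_lipschitz (abs_nonneg c) fun a b => by rw [← mul_sub, abs_mul]

lemma neg (hf : IsCylLip n f) : IsCylLip n (fun x => -f x) := by
  simpa using hf.const_mul (-1)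

lemma sub (hf : IsCylLip n f) (hg : IsCylLip n g) : IsCylLip n (fun x => f x - g x) := by
  simpa only [sub_eq_add_neg] using hf.add hg.neg

lemma const (c : ℝ) : IsCylLip n (fun _ => c) := ⟨0, le_rfl, fun x y => by simp⟩

lemma abs (hf : IsCylLip n f) : IsCylLip n (fun x => |f x|) :=
  hf.comp_lipschitz zero_le_one fun a b => by simpa using abs_abs_sub_abs_le_abs_sub a b

lemma max_const (hf : IsCylLip n f) (c : ℝ) : IsCylLip n (fun x => max c (f x)) :=
  hf.comp_lipschitz zero_le_one fun a b => by simpa using abs_max_sub_max_le_max c a c b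

lemma min_const (hf : IsCylLip n f) (c : ℝ) : IsCylLip n (fun x => min c (f x)) :=
  hf.comp_lipschitz zero_le_one fun a b => by simpa using abs_min_sub_min_le_max c a c b

lemma mono (hf : IsCylLip n f) (h : n ≤ m) : IsCylLip m f := by
  obtain ⟨K, hK0, hK⟩ := hf
  refine ⟨K, hK0, fun x y => (hK x y).trans (mul_le_mul_of_nonneg_left ?_ hK0)⟩
  exact Finset.sum_le_sum_of_subset_of_nonneg (Finset.range_mono h) fun _ _ _ => abs_nonneg _

lemma coord {i : ℕ} (h : i < n) : IsCylLip n (fun x => x i) :=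
  ⟨1, zero_le_one, fun x y => by
    rw [one_mul]
    exact Finset.single_le_sum (f := fun i => |x i - y i|) (fun _ _ => abs_nonneg _)
      (Finset.mem_range.2 h)⟩

lemma sum {ι : Type*} (s : Finset ι) {f : ι → (ℕ → ℝ) → ℝ} (h : ∀ i ∈ s, IsCylLip n (f i)) :
    IsCylLip n (fun x => ∑ i ∈ s, f i x) := by
  classical
  induction s using Finset.induction_on with
  | empty => simpa using const 0
  | insert i s hi ih =>
    simp only [Finset.sum_insert hi]
    exact (h i (by simp)).add (ih fun j hj => h j (by simp [hj]))

lemma congr (hf : IsCylLip n f) {x y : ℕ → ℝ} (h : ∀ i < n, x i = y i) : f x = f y := by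
  obtain ⟨K, hK0, hK⟩ := hf
  have h1 := hK x y
  rw [Finset.sum_eq_zero, mul_zero] at h1
  · exact sub_eq_zero.1 (abs_nonpos_iff.1 h1)
  · intro i hi
    rw [h i (Finset.mem_range.1 hi), sub_self, abs_zero]

lemma continuous (hf : IsCylLip n f) : Continuous f := by
  obtain ⟨K, hK0, hK⟩ := hf
  refine continuous_iff_continuousAt.2 fun x => ?_
  refine tendsto_iff_dist_tendsto_zero.2 ?_
  have h1 : Continuous fun y : ℕ → ℝ => K * ∑ i ∈ Finset.range n, |y i - x i| := by fun_prop
  have h2 := h1.tendsto x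
  simp only [sub_self, abs_zero, Finset.sum_const_zero, mul_zero] at h2
  exact squeeze_zero (fun _ => dist_nonneg) (fun y => hK y x) h2

lemma measurable (hf : IsCylLip n f) : Measurable f := hf.continuous.measurable

end IsCylLip

/-- Extension of a vector by zero to a sequence. -/
def extendZero {n : ℕ} (z : Fin n → ℝ) (i : ℕ) : ℝ := if h : i < n then z ⟨i, h⟩ else 0

lemma measurable_extendZero (n : ℕ) : Measurable fun z : Fin n → ℝ => extendZero z := by
  refine measurable_pi_lambda _ fun i => ?_
  unfold extendZero
  split_ifs <;> fun_prop

lemma abs_extendZero_sub_le {n : ℕ} (z w : Fin n → ℝ) (i : ℕ) :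
    |extendZero z i - extendZero w i| ≤ ‖z - w‖ := by
  unfold extendZero
  split_ifs with h
  · exact norm_le_pi_norm (z - w) ⟨i, h⟩
  · simp

lemma IsCylLip.lipschitz_extendZero {n : ℕ} {f : (ℕ → ℝ) → ℝ} (hf : IsCylLip n f) :
    ∃ C : ℝ, 0 ≤ C ∧ ∀ z w : Fin n → ℝ, |f (extendZero z) - f (extendZero w)| ≤ C * ‖z - w‖ := by
  obtain ⟨K, hK0, hK⟩ := hf
  refine ⟨K * n, by positivity, fun z w => (hK _ _).trans ?_⟩
  rw [mul_assoc]
  refine mul_le_mul_of_nonneg_left ?_ hK0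
  calc _ ≤ ∑ i ∈ Finset.range n, ‖z - w‖ :=
        Finset.sum_le_sum fun i _ => abs_extendZero_sub_le z w i
    _ = _ := by simp

lemma IsCylLip.apply_extendZero {n : ℕ} {f : (ℕ → ℝ) → ℝ} (hf : IsCylLip n f) (x : ℕ → ℝ) :
    f (extendZero fun i : Fin n => x i) = f x :=
  hf.congr fun i hi => by simp [extendZero, hi]

lemma lipschitzWith_of_abs_sub_le {α : Type*} [PseudoMetricSpace α] {f : α → ℝ} {C : ℝ}
    (hC : 0 ≤ C) (h : ∀ x y, |f x - f y| ≤ C * dist x y) : ∃ K, LipschitzWith K f :=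
  ⟨⟨C, hC⟩, LipschitzWith.of_dist_le_mul fun x y => h x y⟩

/-! ### The sub-linear expectation on bounded variables. -/

namespace SublinearExpectation

variable {Ω : Type*} [MeasurableSpace Ω] (S : SublinearExpectation Ω)

lemma cyl_mem {n : ℕ} {f : (ℕ → ℝ) → ℝ} (hf : IsCylLip n f) {X : ℕ → Ω → ℝ}
    (hX : ∀ i, X i ∈ S.H) : (fun ω => f fun i => X i ω) ∈ S.H := by
  obtain ⟨C, hC0, hC⟩ := hf.lipschitz_extendZero
  -- `C` may vanish while `IsLocLip` wants a positive constant, hence `C + 1`; the growth exponent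
  -- is `0`.
  have h := S.comp_mem n (fun z => f (extendZero z)) ⟨C + 1, by linarith, 0, fun x y => ?_⟩
    (fun i => X i) (fun i => hX i)
  · have e : ∀ ω, f (extendZero fun i : Fin n => X i ω) = f fun i => X i ω := fun ω =>
      hf.apply_extendZero fun i => X i ω
    simpa only [e] using h
  · refine (hC x y).trans (mul_le_mul_of_nonneg_right ?_ (norm_nonneg _))
    simp only [pow_zero]
    linarith

lemma cyl_mem_Hb {n : ℕ} {f : (ℕ → ℝ) → ℝ} (hf : IsCylLip n f) (hb : IsBdd f) {X : ℕ → Ω → ℝ}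
    (hX : ∀ i, X i ∈ S.H) : (fun ω => f fun i => X i ω) ∈ S.Hb :=
  ⟨S.cyl_mem hf hX, hb.comp _⟩

lemma lip_mem {h : ℝ → ℝ} {L : ℝ} (hL : 0 ≤ L) (hh : ∀ a b, |h a - h b| ≤ L * |a - b|)
    {Z : Ω → ℝ} (hZ : Z ∈ S.H) : (fun ω => h (Z ω)) ∈ S.H :=
  S.cyl_mem (n := 1) (X := fun _ => Z)
    ((IsCylLip.coord (i := 0) zero_lt_one).comp_lipschitz hL hh) fun _ => hZ

lemma const_mem (c : ℝ) : (fun _ => c) ∈ S.H :=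
  S.cyl_mem (n := 0) (X := fun _ => 0) (IsCylLip.const c) fun _ => S.H.zero_mem

lemma const_mem_Hb (c : ℝ) : (fun _ => c) ∈ S.Hb := ⟨S.const_mem c, IsBdd.const c⟩

lemma add_mem_Hb {A B : Ω → ℝ} (hA : A ∈ S.Hb) (hB : B ∈ S.Hb) :
    (fun ω => A ω + B ω) ∈ S.Hb :=
  ⟨S.H.add_mem hA.1 hB.1, IsBdd.add hA.2 hB.2⟩

lemma neg_mem_Hb {A : Ω → ℝ} (hA : A ∈ S.Hb) : (fun ω => -A ω) ∈ S.Hb :=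
  ⟨S.H.neg_mem hA.1, IsBdd.neg hA.2⟩

lemma sub_mem_Hb {A B : Ω → ℝ} (hA : A ∈ S.Hb) (hB : B ∈ S.Hb) :
    (fun ω => A ω - B ω) ∈ S.Hb :=
  ⟨S.H.sub_mem hA.1 hB.1, IsBdd.sub hA.2 hB.2⟩

/-- The real-valued expectation of a bounded random variable. -/
noncomputable def ev (A : Ω → ℝ) : ℝ := (S.E A).toReal

variable {S}

lemma coe_ev {A : Ω → ℝ} (hA : A ∈ S.Hb) : (S.ev A : EReal) = S.E A := by
  obtain ⟨hA, M, hM⟩ := hA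
  have h1 : S.E A ≤ (M : EReal) := by
    rw [← S.const M]
    exact S.mono _ (S.const_mem M) _ hA fun ω => (le_abs_self _).trans (hM ω)
  have h2 : ((-M : ℝ) : EReal) ≤ S.E A := by
    rw [← S.const (-M)]
    exact S.mono _ hA _ (S.const_mem _) fun ω => neg_le_of_abs_le (hM ω)
  exact EReal.coe_toReal (ne_top_of_le_ne_top (EReal.coe_ne_top _) h1)
    (ne_bot_of_le_ne_bot (EReal.coe_ne_bot _) h2)

lemma ev_const (c : ℝ) : S.ev (fun _ => c) = c := by simp [ev, S.const]

lemma ev_mono {A B : Ω → ℝ} (hA : A ∈ S.Hb) (hB : B ∈ S.Hb) (h : ∀ ω, A ω ≤ B ω) :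
    S.ev A ≤ S.ev B := by
  rw [← EReal.coe_le_coe_iff, coe_ev hA, coe_ev hB]
  exact S.mono _ hB.1 _ hA.1 h

lemma ev_add_le {A B : Ω → ℝ} (hA : A ∈ S.Hb) (hB : B ∈ S.Hb) :
    S.ev (fun ω => A ω + B ω) ≤ S.ev A + S.ev B := by
  rw [← EReal.coe_le_coe_iff, EReal.coe_add, coe_ev hA, coe_ev hB, coe_ev (S.add_mem_Hb hA hB)]
  refine S.subadd _ hA.1 _ hB.1 ?_ ?_
  · rw [← coe_ev hA]
    exact fun h => EReal.coe_ne_top _ h.1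
  · rw [← coe_ev hA]
    exact fun h => EReal.coe_ne_bot _ h.1

lemma abs_ev_sub_le {A B : Ω → ℝ} (hA : A ∈ S.Hb) (hB : B ∈ S.Hb) {c : ℝ}
    (h : ∀ ω, |A ω - B ω| ≤ c) : |S.ev A - S.ev B| ≤ c := by
  have key : ∀ {A B : Ω → ℝ}, A ∈ S.Hb → B ∈ S.Hb → (∀ ω, |A ω - B ω| ≤ c) →
      S.ev A ≤ S.ev B + c := fun {A B} hA hB h => by
    have h1 := ev_add_le hB (S.const_mem_Hb c)
    rw [ev_const] at h1
    refine (ev_mono hA (S.add_mem_Hb hB (S.const_mem_Hb c)) fun ω => ?_).trans h1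
    linarith [le_of_abs_le (h ω)]
  rw [abs_le]
  constructor
  · linarith [key hB hA fun ω => by rw [abs_sub_comm]; exact h ω]
  · linarith [key hA hB h]

lemma abs_ev_le {A : Ω → ℝ} (hA : A ∈ S.Hb) {c : ℝ} (h : ∀ ω, |A ω| ≤ c) : |S.ev A| ≤ c := by
  simpa [ev_const] using abs_ev_sub_le hA (S.const_mem_Hb 0) (c := c) (by simpa using h)

lemma ev_sub_const_ge {A : Ω → ℝ} (hA : A ∈ S.Hb) (c : ℝ) :
    S.ev A - c ≤ S.ev (fun ω => A ω - c) := by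
  have h := ev_add_le (S.sub_mem_Hb hA (S.const_mem_Hb c)) (S.const_mem_Hb c)
  simp only [sub_add_cancel, ev_const] at h
  linarith

/-- Probability measures on `ℝ` dominated by the distribution of `Z` under the sub-linear
expectation. -/
def Dominated (S : SublinearExpectation Ω) (Z : Ω → ℝ) (p : Measure ℝ) : Prop :=
  ∀ φ : ℝ → ℝ, IsBddLip φ → ∫ t, φ t ∂p ≤ S.ev (fun ω => φ (Z ω))

/-! ### Independence as iterated expectation, one coordinate at a time. -/

section peel

variable {X : ℕ → Ω → ℝ} {n : ℕ} {f : (ℕ → ℝ) → ℝ}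

lemma isBddLip_update (hf : IsCylLip (n + 1) f) (hb : IsBdd f) (x : ℕ → ℝ) :
    IsBddLip fun t : ℝ => f (Function.update x n t) := by
  obtain ⟨K, hK0, hK⟩ := hf
  refine ⟨lipschitzWith_of_abs_sub_le hK0 fun s t => (hK _ _).trans (le_of_eq ?_), hb.comp _⟩
  rw [Finset.sum_range_succ, Finset.sum_eq_zero fun i hi => ?_]
  · simp [Real.dist_eq]
  · simp [(Finset.mem_range.1 hi).ne]

lemma update_mem_Hb (hX : S.IsIID X) (hf : IsCylLip (n + 1) f) (hb : IsBdd f) (x : ℕ → ℝ) :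
    (fun ω => f (Function.update x n (X n ω))) ∈ S.Hb := by
  obtain ⟨⟨K, hK⟩, -⟩ := isBddLip_update hf hb x
  exact ⟨S.lip_mem K.2 (fun a b => by simpa [Real.dist_eq] using hK.dist_le_mul a b) (hX.mem n),
    hb.comp _⟩

/-- The expectation in the coordinate `n`, the other coordinates being fixed. -/
noncomputable def peel (S : SublinearExpectation Ω) (X : ℕ → Ω → ℝ) (n : ℕ) (f : (ℕ → ℝ) → ℝ)
    (x : ℕ → ℝ) : ℝ :=
  S.ev (fun ω => f (Function.update x n (X n ω)))

lemma peel_cyl (hX : S.IsIID X) (hf : IsCylLip (n + 1) f) (hb : IsBdd f) :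
    IsCylLip n (S.peel X n f) := by
  have hf' := hf
  obtain ⟨K, hK0, hK⟩ := hf
  refine ⟨K, hK0, fun x y => ?_⟩
  refine abs_ev_sub_le (update_mem_Hb hX hf' hb x) (update_mem_Hb hX hf' hb y) fun ω =>
    (hK _ _).trans (le_of_eq ?_)
  rw [Finset.sum_range_succ]
  simp only [Function.update_self, sub_self, abs_zero, add_zero]
  congr 1
  refine Finset.sum_congr rfl fun i hi => ?_
  simp [(Finset.mem_range.1 hi).ne]

lemma peel_bdd (hX : S.IsIID X) (hf : IsCylLip (n + 1) f) (hb : IsBdd f) :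
    IsBdd (S.peel X n f) := by
  obtain ⟨M, hM⟩ := id hb
  exact ⟨M, fun x => abs_ev_le (update_mem_Hb hX hf hb x) fun ω => hM _⟩

/-- Independence of `X n` from its predecessors, transported to functions on `ℝ^ℕ`. Independence is
postulated only for `X (k + 1)`, which is why `n = 0` is excluded and all blocks start at an index
`≥ 1`. -/
lemma ev_peel (hX : S.IsIID X) (hn : 1 ≤ n) (hf : IsCylLip (n + 1) f) (hb : IsBdd f) :
    S.ev (fun ω => S.peel X n f fun i => X i ω) = S.ev (fun ω => f fun i => X i ω) := by
  obtain ⟨k, rfl⟩ : ∃ k, n = k + 1 := ⟨n - 1, by omega⟩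
  have h := hX.indep k (fun z => f (Function.update (extendZero z.1) (k + 1) z.2)) ⟨?_, hb.comp _⟩
  · have e1 : ∀ x : ℕ → ℝ, ∀ t, f (Function.update (extendZero fun i : Fin (k + 1) => x i)
        (k + 1) t) = f (Function.update x (k + 1) t) := fun x t => hf.congr fun i hi => by
      rcases eq_or_ne i (k + 1) with rfl | hne
      · simp
      · have : i < k + 1 := by omega
        simp [hne, extendZero, this]
    have e2 : ∀ x : ℕ → ℝ, Function.update x (k + 1) (x (k + 1)) = x := fun x =>
      Function.update_eq_self _ _
    have e3 : ∀ ω, (S.E fun ω' => f (Function.update (extendZero fun i : Fin (k + 1) => X i ω)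
        (k + 1) (X (k + 1) ω'))).toReal = S.peel X (k + 1) f fun i => X i ω := fun ω => by
      unfold peel ev
      congr 2
      funext ω'
      exact e1 (fun i => X i ω) _
    simp only [e3] at h
    simp only [ev, ← h]
    congr 2
    funext ω
    rw [e1 (fun i => X i ω), e2 fun i => X i ω]
  · obtain ⟨K, hK0, hK⟩ := hf
    refine lipschitzWith_of_abs_sub_le (C := K * (k + 2 : ℕ)) (by positivity) fun z w =>
      (hK _ _).trans ?_
    rw [mul_assoc]
    refine mul_le_mul_of_nonneg_left ?_ hK0
    calc _ ≤ ∑ i ∈ Finset.range (k + 2), dist z w := Finset.sum_le_sum fun i _ => ?_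
      _ = _ := by simp
    rcases eq_or_ne i (k + 1) with rfl | hne
    · simp only [Function.update_self, ← Real.dist_eq]
      exact le_max_right _ _
    · simp only [Function.update_of_ne hne]
      refine (abs_extendZero_sub_le _ _ i).trans ?_
      rw [← dist_eq_norm]
      exact le_max_left _ _

/-- Since all coordinates have the distribution of `X 0`, one dominated law bounds the inner
expectation from below in each of them. As `x` is fixed here, `p` may depend on it. -/
lemma integral_le_peel (hX : S.IsIID X) (hf : IsCylLip (n + 1) f) (hb : IsBdd f)
    {p : Measure ℝ} (hp : S.Dominated (X 0) p) (x : ℕ → ℝ) :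
    ∫ t, f (Function.update x n t) ∂p ≤ S.peel X n f x := by
  refine (hp _ (isBddLip_update hf hb x)).trans (le_of_eq ?_)
  unfold peel ev
  rw [hX.identDistrib n _ (isBddLip_update hf hb x)]

end peel

/-! ### Product measures on the future, given the past. -/

/-- The sequence with the first `m` terms of `x`, followed by `y`. -/
def splice (m : ℕ) (x y : ℕ → ℝ) (i : ℕ) : ℝ := if i < m then x i else y (i - m)

lemma measurable_splice (m : ℕ) (x : ℕ → ℝ) : Measurable (splice m x) := by
  refine measurable_pi_lambda _ fun i => ?_
  unfold splice
  split_ifs <;> fun_prop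

lemma update_splice (m j : ℕ) (x y : ℕ → ℝ) (t : ℝ) :
    Function.update (splice m x y) (m + j) t = splice m x (Function.update y j t) := by
  funext i
  by_cases h : i = m + j
  · subst h; simp [splice]
  · by_cases h' : i < m
    · simp [splice, h, h']
    · have : i - m ≠ j := by omega
      simp [splice, h, h', this]

lemma measurable_update_prod (j : ℕ) :
    Measurable fun z : (ℕ → ℝ) × ℝ => Function.update z.1 j z.2 := by
  refine measurable_pi_lambda _ fun i => ?_
  by_cases h : i = j
  · subst h; simpa using measurable_snd
  · simp only [Function.update_of_ne h]; fun_prop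

/-- Redrawing one coordinate independently preserves a product measure. With Fubini this integrates
out coordinate `j` without splitting the infinite product. -/
lemma map_update_infinitePi (p : Measure ℝ) [IsProbabilityMeasure p] (j : ℕ) :
    ((Measure.infinitePi fun _ : ℕ => p).prod p).map (fun z => Function.update z.1 j z.2) =
      Measure.infinitePi fun _ : ℕ => p := by
  have hmeas := measurable_update_prod j
  refine Measure.eq_infinitePi _ fun s t ht => ?_
  rw [Measure.map_apply hmeas (MeasurableSet.pi s.countable_toSet fun i _ => ht i)]
  by_cases hj : j ∈ s
  · have : (fun z : (ℕ → ℝ) × ℝ => Function.update z.1 j z.2) ⁻¹' (Set.pi s t) =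
        (Set.pi (s.erase j) t) ×ˢ t j := by
      ext z
      simp only [Set.mem_preimage, Set.mem_pi, Set.mem_prod, Finset.mem_coe, Finset.mem_erase]
      constructor
      · refine fun h => ⟨fun i hi => ?_, ?_⟩
        · simpa [hi.1] using h i hi.2
        · simpa using h j hj
      · rintro ⟨h1, h2⟩ i hi
        by_cases h : i = j
        · subst h; simpa using h2
        · simpa [h] using h1 i ⟨h, hi⟩
    rw [this, Measure.prod_prod, Measure.infinitePi_pi _ fun i _ => ht i, mul_comm,
      Finset.mul_prod_erase s (fun i => p (t i)) hj]
  · have : (fun z : (ℕ → ℝ) × ℝ => Function.update z.1 j z.2) ⁻¹' (Set.pi s t) =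
        (Set.pi s t) ×ˢ Set.univ := by
      ext z
      simp only [Set.mem_preimage, Set.mem_pi, Set.mem_prod, Finset.mem_coe, Set.mem_univ, and_true]
      refine forall₂_congr fun i hi => ?_
      rw [Function.update_of_ne (fun h : i = j => hj (h ▸ Finset.mem_coe.1 hi))]
    rw [this, Measure.prod_prod, Measure.infinitePi_pi _ fun i _ => ht i, measure_univ, mul_one]

lemma integrable_of_bdd {α : Type*} [MeasurableSpace α] {μ : Measure α} [IsFiniteMeasure μ]
    {f : α → ℝ} (hf : Measurable f) (hb : IsBdd f) : Integrable f μ := by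
  obtain ⟨M, hM⟩ := hb
  exact Integrable.of_bound hf.aestronglyMeasurable M (ae_of_all _ hM)

/-- `F` is `f` with the coordinates `m, …, m + j - 1` peeled off, the last one first. It is
independent of `p`, so the same `F` dominates the integrals for all `p`, and `p` can be chosen
pointwise in the past `x`. -/
lemma exists_block {X : ℕ → Ω → ℝ} (hX : S.IsIID X) {m : ℕ} (hm : 1 ≤ m) (j : ℕ) :
    ∀ f, IsCylLip (m + j) f → IsBdd f → ∃ F, IsCylLip m F ∧ IsBdd F ∧
      S.ev (fun ω => F fun i => X i ω) = S.ev (fun ω => f fun i => X i ω) ∧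
      ∀ p : Measure ℝ, IsProbabilityMeasure p → S.Dominated (X 0) p → ∀ x,
        ∫ y, f (splice m x y) ∂(Measure.infinitePi fun _ : ℕ => p) ≤ F x := by
  induction j with
  | zero =>
    intro f hf hb
    refine ⟨f, hf, hb, rfl, fun p _ _ x => le_of_eq ?_⟩
    have : ∀ y, f (splice m x y) = f x := fun y => hf.congr fun i hi => by
      have : i < m := hi
      simp [splice, this]
    simp [this]
  | succ j ih =>
    intro f hf hb
    have hf1 := peel_cyl (n := m + j) hX hf hb
    have hb1 := peel_bdd (n := m + j) hX hf hb
    obtain ⟨F, hF, hFb, hFe, hFp⟩ := ih _ hf1 hb1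
    refine ⟨F, hF, hFb, hFe.trans (ev_peel hX (by omega) hf hb), fun p hp hdom x =>
      le_trans ?_ (hFp p hp hdom x)⟩
    have hmeas := measurable_update_prod j
    have hfm : Measurable fun y => f (splice m x y) := hf.measurable.comp (measurable_splice m x)
    have hI : Integrable (fun z : (ℕ → ℝ) × ℝ => f (splice m x (Function.update z.1 j z.2)))
        ((Measure.infinitePi fun _ : ℕ => p).prod p) :=
      integrable_of_bdd (hfm.comp hmeas) (hb.comp _)
    conv_lhs => rw [← map_update_infinitePi p j]
    rw [integral_map hmeas.aemeasurable hfm.aestronglyMeasurable, integral_prod _ hI]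
    refine integral_mono hI.integral_prod_left
      (integrable_of_bdd (hf1.measurable.comp (measurable_splice m x)) (hb1.comp _)) fun y => ?_
    simp only [← update_splice]
    exact integral_le_peel hX hf hb hdom _

/-- Subtracting a penalty which, given any past, is small under some dominated product measure
costs little. -/
lemma ev_sub_penalty_ge {X : ℕ → Ω → ℝ} (hX : S.IsIID X) {m n : ℕ} (hm : 1 ≤ m) (hmn : m ≤ n)
    {f g : (ℕ → ℝ) → ℝ} (hf : IsCylLip m f) (hfb : IsBdd f) (hg : IsCylLip n g) (hgb : IsBdd g)
    {δ : ℝ} (h : ∀ x, ∃ p : Measure ℝ, IsProbabilityMeasure p ∧ S.Dominated (X 0) p ∧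
      ∫ y, g (splice m x y) ∂(Measure.infinitePi fun _ : ℕ => p) ≤ δ) :
    S.ev (fun ω => f fun i => X i ω) - δ ≤
      S.ev (fun ω => f (fun i => X i ω) - g fun i => X i ω) := by
  obtain ⟨j, rfl⟩ := Nat.exists_eq_add_of_le hmn
  obtain ⟨F, hF, hFb, hFe, hFp⟩ := exists_block hX hm j (fun x => f x - g x)
    ((hf.mono hmn).sub hg) (hfb.sub hgb)
  rw [← hFe]
  refine (ev_sub_const_ge (S.cyl_mem_Hb hf hfb hX.mem) δ).trans (ev_mono
    (S.sub_mem_Hb (S.cyl_mem_Hb hf hfb hX.mem) (S.const_mem_Hb δ))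
    (S.cyl_mem_Hb hF hFb hX.mem) fun ω => ?_)
  obtain ⟨p, hp, hdom, hle⟩ := h fun i => X i ω
  refine le_trans ?_ (hFp p hp hdom _)
  have e : ∀ y, f (splice m (fun i => X i ω) y) = f fun i => X i ω := fun y =>
    hf.congr fun i hi => by simp [splice, hi]
  simp only [e]
  have hI : Integrable (fun y => g (splice m (fun i => X i ω) y))
      (Measure.infinitePi fun _ : ℕ => p) :=
    integrable_of_bdd (hg.measurable.comp (measurable_splice m _)) (hgb.comp _)
  rw [integral_sub (integrable_const _) hI]
  simp only [integral_const, probReal_univ, one_smul]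
  linarith

end SublinearExpectation

/-! ### Dominated measures, capacities and weak compactness. -/

namespace SublinearExpectation

variable {Ω : Type*} [MeasurableSpace Ω] {S : SublinearExpectation Ω}

lemma measurable_sigma {Z : Ω → ℝ} (hZ : Z ∈ S.H) : Measurable[S.sigma] Z :=
  measurable_iff_comap_le.2 (le_iSup₂_of_le (f := fun X (_ : X ∈ S.H) =>
    MeasurableSpace.comap X (borel ℝ)) Z hZ le_rfl)

lemma measurable_seq {X : ℕ → Ω → ℝ} (hX : ∀ i, X i ∈ S.H) :
    Measurable[S.sigma] (fun ω i => X i ω) :=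
  @measurable_pi_lambda Ω ℕ (fun _ => ℝ) S.sigma _ _ fun i => measurable_sigma (hX i)

lemma integrable_Hb {A : Ω → ℝ} (hA : A ∈ S.Hb) (P : S.Prob) :
    Integrable A (P : @Measure Ω S.sigma) :=
  @integrable_of_bdd Ω S.sigma _ _ _ (measurable_sigma hA.1) hA.2

variable {Ps : Set S.Prob}

lemma subset_maxFamily (hCC : S.ConditionCC Ps) : Ps ⊆ S.maxFamily := fun P hP A hA => by
  rw [hCC.eq_sup A hA]
  exact le_iSup₂ (f := fun (P : S.Prob) (_ : P ∈ Ps) =>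
    ((∫ ω, A ω ∂(P : @Measure Ω S.sigma) : ℝ) : EReal)) P hP

lemma integral_le_ev {P : S.Prob} (hP : P ∈ S.maxFamily) {A : Ω → ℝ} (hA : A ∈ S.Hb) :
    ∫ ω, A ω ∂(P : @Measure Ω S.sigma) ≤ S.ev A := by
  rw [← EReal.coe_le_coe_iff, coe_ev hA]
  exact hP A hA

lemma exists_lt_integral (hCC : S.ConditionCC Ps) {A : Ω → ℝ} (hA : A ∈ S.Hb) {c : ℝ}
    (hc : c < S.ev A) : ∃ P ∈ Ps, c < ∫ ω, A ω ∂(P : @Measure Ω S.sigma) := by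
  rw [← EReal.coe_lt_coe_iff, coe_ev hA, hCC.eq_sup A hA, lt_iSup_iff] at hc
  obtain ⟨P, hP⟩ := hc
  obtain ⟨h, h'⟩ := lt_iSup_iff.1 hP
  exact ⟨P, h, EReal.coe_lt_coe_iff.1 h'⟩

lemma nonempty_of_conditionCC (hCC : S.ConditionCC Ps) : Ps.Nonempty := by
  obtain ⟨P, hP, -⟩ := exists_lt_integral hCC (S.const_mem_Hb 0) (c := -1) (by
    rw [ev_const]; norm_num)
  exact ⟨P, hP⟩

/-- Markov's inequality for `min 1 ξ`, which lies in `H_b` whereas `ξ` need not. The set `A` may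
fail to be `σ(H)`-measurable; `P A` is then its outer measure. -/
lemma measure_le_upperCapacity {P : S.Prob} (hP : P ∈ S.maxFamily) (A : Set Ω) :
    (P : @Measure Ω S.sigma) A ≤ S.upperCapacity A := by
  refine le_iInf fun ξ => le_iInf fun hξ => le_iInf fun hA => ?_
  have h0 : ∀ ω, 0 ≤ ξ ω := fun ω => (Set.indicator_nonneg (by simp) ω).trans (hA ω)
  have hη : (fun ω => min 1 (ξ ω)) ∈ S.Hb :=
    ⟨S.lip_mem zero_le_one (fun a b => by simpa using abs_min_sub_min_le_max 1 a 1 b) hξ,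
      IsBdd.of_mem_Icc (a := 0) (b := 1) fun ω =>
        ⟨le_min zero_le_one (h0 ω), min_le_left _ _⟩⟩
  calc (P : @Measure Ω S.sigma) A
      ≤ (P : @Measure Ω S.sigma) {ω | 1 ≤ ENNReal.ofReal (min 1 (ξ ω))} := by
        refine measure_mono fun ω hω => ?_
        have h1 := hA ω
        rw [Set.indicator_of_mem hω] at h1
        simp [h1]
    _ ≤ ∫⁻ ω, ENNReal.ofReal (min 1 (ξ ω)) ∂(P : @Measure Ω S.sigma) := by
        have := @mul_meas_ge_le_lintegral Ω S.sigma (P : @Measure Ω S.sigma)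
          (fun ω => ENNReal.ofReal (min 1 (ξ ω)))
          (ENNReal.measurable_ofReal.comp (measurable_sigma hη.1)) 1
        simpa using this
    _ = ENNReal.ofReal (∫ ω, min 1 (ξ ω) ∂(P : @Measure Ω S.sigma)) :=
        (ofReal_integral_eq_lintegral_ofReal (integrable_Hb hη P)
          (ae_of_all _ fun ω => le_min zero_le_one (h0 ω))).symm
    _ = ((∫ ω, min 1 (ξ ω) ∂(P : @Measure Ω S.sigma) : ℝ) : EReal).toENNReal := by
        rw [EReal.toENNReal_of_ne_top (EReal.coe_ne_top _), EReal.toReal_coe]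
    _ ≤ (S.E ξ).toENNReal := EReal.toENNReal_le_toENNReal
        ((hP _ hη).trans (S.mono _ hξ _ hη.1 fun ω => min_le_right _ _))

/-- For any countable cover, `1 = P A ≤ ∑ P (B n) ≤ ∑ V (B n)`. The reverse bound comes from the
cover by the whole space and empty sets. -/
lemma outerCapacity_eq_one {P : S.Prob} (hP : P ∈ S.maxFamily) {A : Set Ω}
    (hA : (P : @Measure Ω S.sigma) A = 1) : S.outerCapacity A = 1 := by
  apply le_antisymm
  · refine (iInf_le _ fun n : ℕ => if n = 0 then Set.univ else ∅).trans ?_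
    refine (iInf_le _ fun n => ?_).trans ((iInf_le _ ?_).trans ?_)
    · dsimp only
      split_ifs <;> simp
    · exact fun ω _ => Set.mem_iUnion.2 ⟨0, by simp⟩
    · have h0 : S.upperCapacity (∅ : Set Ω) = 0 := by
        refine le_antisymm ((iInf₂_le (fun _ => 0) (S.const_mem 0)).trans
          ((iInf_le _ fun ω => by simp).trans ?_)) zero_le
        rw [S.const]; simp
      have h1 : S.upperCapacity (Set.univ : Set Ω) ≤ 1 := by
        refine (iInf₂_le (fun _ => 1) (S.const_mem 1)).trans
          ((iInf_le _ fun ω => by simp).trans ?_)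
        rw [S.const, EReal.toENNReal_of_ne_top (EReal.coe_ne_top _), EReal.toReal_coe]
        simp
      rw [tsum_eq_single 0 fun n hn => by simp [hn, h0]]
      simpa using h1
  · refine le_iInf fun B => le_iInf fun _ => le_iInf fun hAB => ?_
    rw [← hA]
    exact (measure_mono hAB).trans ((measure_iUnion_le B).trans
      (ENNReal.tsum_le_tsum fun n => measure_le_upperCapacity hP (B n)))

/-- The compactness part of condition (CC): countably many constraints on bounded expectations
can be met as soon as finitely many can. -/
lemma exists_forall_integral_le (hCC : S.ConditionCC Ps) {Y : ℕ → Ω → ℝ}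
    (hY : ∀ k, Y k ∈ S.Hb) {c : ℕ → ℝ}
    (h : ∀ K, ∃ P ∈ Ps, ∀ k ≤ K, ∫ ω, Y k ω ∂(P : @Measure Ω S.sigma) ≤ c k) :
    ∃ P ∈ Ps, ∀ k, ∫ ω, Y k ω ∂(P : @Measure Ω S.sigma) ≤ c k := by
  choose M hM using fun k => (hY k).2
  have hM0 : ∀ k, 0 ≤ |M k| := fun k => abs_nonneg _
  -- Clipping at `|M k|` leaves `Y k` unchanged and turns the coordinate into a bounded continuous
  -- function. Each constraint is thus weakly closed in the law of `Y`, and the finite intersection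
  -- property applies.
  let g : ℕ → (ℕ → ℝ) →ᵇ ℝ := fun k => BoundedContinuousFunction.ofNormedAddCommGroup
    (fun y => max (-|M k|) (min (y k) |M k|)) (by fun_prop) |M k| fun y => by
      rw [Real.norm_eq_abs, abs_le]
      exact ⟨le_max_left _ _, max_le (by linarith [hM0 k]) (min_le_right _ _)⟩
  have hg : ∀ k ω, g k (fun i => Y i ω) = Y k ω := fun k ω => by
    have := abs_le.1 ((hM k ω).trans (le_abs_self _))
    simp [g, this.1, this.2]
  have hm := measurable_seq (S := S) fun k => (hY k).1
  have hint : ∀ (P : S.Prob) (ν : ProbabilityMeasure (ℕ → ℝ)),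
      (∀ A : Set (ℕ → ℝ), MeasurableSet A → (ν : Measure (ℕ → ℝ)) A =
        (P : @Measure Ω S.sigma) {ω | (fun i => Y i ω) ∈ A}) →
      ∀ k, ∫ y, g k y ∂(ν : Measure (ℕ → ℝ)) = ∫ ω, Y k ω ∂(P : @Measure Ω S.sigma) := by
    intro P ν hν k
    have e : (ν : Measure (ℕ → ℝ)) =
        @Measure.map _ _ S.sigma _ (fun ω i => Y i ω) (P : @Measure Ω S.sigma) := by
      ext A hA
      rw [hν A hA, Measure.map_apply hm hA]
      rfl
    rw [e, integral_map hm.aemeasurable (g k).continuous.aestronglyMeasurable]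
    simp only [hg]
  have hfin : ∀ u : Finset ℕ, (S.laws Ps Y ∩ ⋂ k ∈ u,
      {ν : ProbabilityMeasure (ℕ → ℝ) | ∫ y, g k y ∂(ν : Measure (ℕ → ℝ)) ≤ c k}).Nonempty := by
    intro u
    obtain ⟨P, hP, hPu⟩ := h (u.sup id)
    let ν : ProbabilityMeasure (ℕ → ℝ) := ⟨@Measure.map _ _ S.sigma _ (fun ω i => Y i ω)
      (P : @Measure Ω S.sigma), Measure.isProbabilityMeasure_map hm.aemeasurable⟩
    have hν : ∀ A : Set (ℕ → ℝ), MeasurableSet A → (ν : Measure (ℕ → ℝ)) A =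
        (P : @Measure Ω S.sigma) {ω | (fun i => Y i ω) ∈ A} := fun A hA =>
      Measure.map_apply hm hA
    refine ⟨ν, ⟨P, hP, hν⟩, Set.mem_iInter₂.2 fun k hk => ?_⟩
    rw [Set.mem_ofPred_eq, hint P ν hν k]
    exact hPu k (Finset.le_sup (f := id) hk)
  obtain ⟨ν, ⟨P, hP, hν⟩, hν'⟩ := (hCC.compact Y hY).inter_iInter_nonempty _
    (fun k => isClosed_le
      (ProbabilityMeasure.continuous_integral_boundedContinuousFunction (g k)) continuous_const)
    hfin
  refine ⟨P, hP, fun k => ?_⟩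
  rw [← hint P ν hν k]
  exact Set.mem_iInter.1 hν' k

/-! ### Finite Choquet moment and the extended means. -/

section mean

variable {Z : Ω → ℝ}

/-- The tail of the Choquet integral of `|Z|`. -/
noncomputable def tail (S : SublinearExpectation Ω) (Z : Ω → ℝ) (c : ℝ) : ℝ≥0∞ :=
  ∫⁻ t in Set.Ioi c, S.upperCapacity {ω | t ≤ |Z ω|}

/-- The part of the Choquet integral over negative levels vanishes because `V` of the whole space is
at least `1`. This has to be checked, since `⊤ - ⊤ = ⊥` in `EReal`. -/
lemma tail_zero_ne_top (h : S.choquet (fun ω => |Z ω|) < ⊤) : S.tail Z 0 ≠ ⊤ := by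
  intro htop
  have huniv : ∀ t ∈ Set.Iio (0 : ℝ), 1 - S.upperCapacity {ω | t ≤ |Z ω|} = 0 := by
    intro t ht
    have : {ω | t ≤ |Z ω|} = Set.univ :=
      Set.eq_univ_of_forall fun ω => show t ≤ |Z ω| from (le_of_lt ht).trans (abs_nonneg _)
    rw [this, tsub_eq_zero_iff_le]
    refine le_iInf fun ξ => le_iInf fun hξ => le_iInf fun h1 => ?_
    have h2 : ((1 : ℝ) : EReal) ≤ S.E ξ := by
      rw [← S.const 1]
      exact S.mono _ hξ _ (S.const_mem 1) fun ω => by simpa using h1 ω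
    have h3 := EReal.toENNReal_le_toENNReal h2
    rwa [EReal.toENNReal_of_ne_top (EReal.coe_ne_top _), EReal.toReal_coe,
      ENNReal.ofReal_one] at h3
  unfold choquet at h
  rw [setLIntegral_congr_fun measurableSet_Iio huniv, lintegral_zero] at h
  unfold tail at htop
  rw [htop] at h
  simp at h

lemma tendsto_tail (h : S.tail Z 0 ≠ ⊤) :
    Tendsto (fun c => (S.tail Z c).toReal) atTop (𝓝 0) := by
  have h1 := tendsto_measure_iInter_atTop (ι := ℝ)
    (μ := volume.withDensity fun t => S.upperCapacity {ω | t ≤ |Z ω|}) (s := Set.Ioi)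
    (fun c => measurableSet_Ioi.nullMeasurableSet) (fun a b h => Set.Ioi_subset_Ioi h)
    ⟨0, by rwa [withDensity_apply _ measurableSet_Ioi]⟩
  have h2 : (⋂ c : ℝ, Set.Ioi c) = ∅ :=
    Set.eq_empty_of_forall_notMem fun x hx => lt_irrefl x (Set.mem_iInter.1 hx x)
  rw [h2, measure_empty] at h1
  have h3 := (ENNReal.tendsto_toReal ENNReal.zero_ne_top).comp h1
  refine h3.congr fun c => ?_
  simp only [Function.comp]
  rw [withDensity_apply _ measurableSet_Ioi]
  rfl

lemma tail_anti (Z : Ω → ℝ) : Antitone (S.tail Z) := fun _ _ h =>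
  lintegral_mono_set (Set.Ioi_subset_Ioi h)

/-- Layer-cake formula, `P ≤ V`, and a shift of the integration variable by `c`. This makes
truncation errors uniform over all dominated measures. -/
lemma lintegral_excess_le (hZ : Z ∈ S.H) {P : S.Prob} (hP : P ∈ S.maxFamily) (c : ℝ) :
    ∫⁻ ω, ENNReal.ofReal (max 0 (|Z ω| - c)) ∂(P : @Measure Ω S.sigma) ≤ S.tail Z c := by
  have hm : Measurable[S.sigma] fun ω => max 0 (|Z ω| - c) := by
    have h1 : Measurable fun z : ℝ => max 0 (|z| - c) := by fun_prop
    exact h1.comp (measurable_sigma hZ)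
  rw [@lintegral_eq_lintegral_meas_le Ω S.sigma (fun ω => max 0 (|Z ω| - c))
    (P : @Measure Ω S.sigma) (ae_of_all _ fun ω => le_max_left _ _) hm.aemeasurable]
  calc _ ≤ ∫⁻ t in Set.Ioi (0 : ℝ), S.upperCapacity {ω | t + c ≤ |Z ω|} := by
        refine setLIntegral_mono' measurableSet_Ioi fun t ht =>
          (measure_mono fun ω hω => ?_).trans (measure_le_upperCapacity hP _)
        have ht : 0 < t := ht
        rcases le_max_iff.1 (show t ≤ max 0 (|Z ω| - c) from hω) with h | h
        · linarith
        · show t + c ≤ |Z ω|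
          linarith
    _ = _ := by
        have := (measurePreserving_add_right (volume : Measure ℝ) c).setLIntegral_comp_preimage_emb
          (MeasurableEquiv.addRight c).measurableEmbedding
          (fun t => S.upperCapacity {ω | t ≤ |Z ω|}) (Set.Ioi c)
        rw [Set.preimage_add_const_Ioi, sub_self] at this
        exact this

lemma integrable_of_tail (hZ : Z ∈ S.H) (h : S.tail Z 0 ≠ ⊤) {P : S.Prob}
    (hP : P ∈ S.maxFamily) : Integrable Z (P : @Measure Ω S.sigma) := by
  refine ⟨(measurable_sigma hZ).aestronglyMeasurable, ?_⟩
  rw [hasFiniteIntegral_iff_norm]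
  refine lt_of_le_of_lt ?_ h.lt_top
  simpa using lintegral_excess_le hZ hP 0

/-- Truncation at level `c`. -/
noncomputable def trunc (c z : ℝ) : ℝ := max (-c) (min z c)

lemma trunc_lip (c a b : ℝ) : |trunc c a - trunc c b| ≤ 1 * |a - b| := by
  rw [one_mul]
  unfold trunc
  refine (abs_max_sub_max_le_max _ _ _ _).trans ?_
  simpa using abs_min_sub_min_le_max a c b c

lemma abs_sub_trunc_le {c : ℝ} (hc : 0 ≤ c) (z : ℝ) : |z - trunc c z| ≤ max 0 (|z| - c) := by
  unfold trunc
  rcases le_total z c with h | h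
  · rw [min_eq_left h]
    rcases le_total (-c) z with h' | h'
    · simp [max_eq_right h']
    · rw [max_eq_left h', abs_of_nonpos (show z ≤ 0 by linarith),
        abs_of_nonpos (show z - -c ≤ 0 by linarith)]
      exact le_max_of_le_right (by linarith)
  · rw [min_eq_right h, max_eq_right (by linarith), abs_of_nonneg (show 0 ≤ z by linarith),
      abs_of_nonneg (show 0 ≤ z - c by linarith)]
    exact le_max_right _ _

lemma trunc_mem_Icc {c : ℝ} (hc : 0 ≤ c) (z : ℝ) : trunc c z ∈ Set.Icc (-c) c :=
  ⟨le_max_left _ _, max_le (by linarith) (min_le_right _ _)⟩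

lemma trunc_mem_Hb (hZ : Z ∈ S.H) {c : ℝ} (hc : 0 ≤ c) : (fun ω => trunc c (Z ω)) ∈ S.Hb :=
  ⟨S.lip_mem zero_le_one (trunc_lip c) hZ, IsBdd.of_mem_Icc fun ω => trunc_mem_Icc hc (Z ω)⟩

lemma abs_integral_sub_trunc_le (hZ : Z ∈ S.H) (h : S.tail Z 0 ≠ ⊤) {P : S.Prob}
    (hP : P ∈ S.maxFamily) {c : ℝ} (hc : 0 ≤ c) :
    |∫ ω, Z ω ∂(P : @Measure Ω S.sigma) - ∫ ω, trunc c (Z ω) ∂(P : @Measure Ω S.sigma)|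
      ≤ (S.tail Z c).toReal := by
  have htop : S.tail Z c ≠ ⊤ := ne_top_of_le_ne_top h (tail_anti Z hc)
  rw [← integral_sub (integrable_of_tail hZ h hP) (integrable_Hb (trunc_mem_Hb hZ hc) P),
    ← Real.norm_eq_abs]
  refine (norm_integral_le_lintegral_norm _).trans (ENNReal.toReal_mono htop ?_)
  refine (lintegral_mono fun ω => ?_).trans (lintegral_excess_le hZ hP c)
  exact ENNReal.ofReal_le_ofReal (abs_sub_trunc_le hc _)

/-- The extended upper mean is the supremum of the means under the members of `Ps`. -/
lemma exists_upperMean (hCC : S.ConditionCC Ps) (hZ : Z ∈ S.H) (h : S.tail Z 0 ≠ ⊤) :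
    ∃ μ : ℝ, S.upperMean Z = μ ∧ (∀ P ∈ Ps, ∫ ω, Z ω ∂(P : @Measure Ω S.sigma) ≤ μ) ∧
      ∀ ε > 0, ∃ P ∈ Ps, |∫ ω, Z ω ∂(P : @Measure Ω S.sigma) - μ| ≤ ε := by
  have hmax := subset_maxFamily hCC
  let s : Set ℝ := (fun P : S.Prob => ∫ ω, Z ω ∂(P : @Measure Ω S.sigma)) '' Ps
  have hne : s.Nonempty := (nonempty_of_conditionCC hCC).image _
  have hbdd : BddAbove s := by
    refine ⟨(S.tail Z 0).toReal, ?_⟩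
    rintro _ ⟨P, hP, rfl⟩
    -- Truncation at level `0` gives the zero function, so the truncation error is the mean itself.
    have h1 := abs_integral_sub_trunc_le hZ h (hmax hP) le_rfl
    have h2 : ∀ z, trunc 0 z = 0 := fun z => by
      have := trunc_mem_Icc le_rfl z
      simpa using this
    simp only [h2, integral_zero, sub_zero] at h1
    exact le_of_abs_le h1
  have hclose : ∀ c, 0 ≤ c → |S.ev (fun ω => trunc c (Z ω)) - sSup s| ≤ (S.tail Z c).toReal := by
    intro c hc
    rw [abs_le]
    constructor
    · suffices sSup s ≤ S.ev (fun ω => trunc c (Z ω)) + (S.tail Z c).toReal by linarith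
      refine csSup_le hne ?_
      rintro _ ⟨P, hP, rfl⟩
      have h1 := le_of_abs_le (abs_integral_sub_trunc_le hZ h (hmax hP) hc)
      have h2 := integral_le_ev (hmax hP) (trunc_mem_Hb hZ hc)
      simp only
      linarith
    · refine le_of_forall_pos_lt_add fun ε hε => ?_
      obtain ⟨P, hP, hlt⟩ := exists_lt_integral hCC (trunc_mem_Hb hZ hc)
        (c := S.ev (fun ω => trunc c (Z ω)) - ε) (by linarith)
      have h1 := neg_le_of_abs_le (abs_integral_sub_trunc_le hZ h (hmax hP) hc)
      have h2 : _ ≤ sSup s := le_csSup hbdd ⟨P, hP, rfl⟩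
      simp only at h2
      linarith
  refine ⟨sSup s, ?_, fun P hP => le_csSup hbdd ⟨P, hP, rfl⟩, fun ε hε => ?_⟩
  · have h1 : Tendsto (fun c => S.ev (fun ω => trunc c (Z ω))) atTop (𝓝 (sSup s)) := by
      refine tendsto_iff_dist_tendsto_zero.2 (squeeze_zero' (Eventually.of_forall fun _ =>
        dist_nonneg) ?_ (tendsto_tail h))
      filter_upwards [eventually_ge_atTop 0] with c hc using hclose c hc
    have h2 := (continuous_coe_real_ereal.tendsto (sSup s)).comp h1
    refine (h2.congr' ?_).limUnder_eq
    filter_upwards [eventually_ge_atTop 0] with c hc using coe_ev (trunc_mem_Hb hZ hc)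
  · obtain ⟨_, ⟨P, hP, rfl⟩, hlt⟩ := exists_lt_of_lt_csSup hne (show sSup s - ε < sSup s by linarith)
    refine ⟨P, hP, abs_le.2 ⟨?_, ?_⟩⟩
    · simp only at hlt
      linarith
    · have h2 : _ ≤ sSup s := le_csSup hbdd ⟨P, hP, rfl⟩
      simp only at h2
      linarith

lemma law_dominated (hZ : Z ∈ S.H) {P : S.Prob} (hP : P ∈ S.maxFamily) :
    S.Dominated Z (@Measure.map _ _ S.sigma _ Z (P : @Measure Ω S.sigma)) := by
  rintro φ ⟨⟨K, hK⟩, hb⟩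
  rw [integral_map (measurable_sigma hZ).aemeasurable hK.continuous.aestronglyMeasurable]
  exact integral_le_ev hP ⟨S.lip_mem K.2 (fun a b => by
    simpa [Real.dist_eq] using hK.dist_le_mul a b) hZ, IsBdd.comp hb Z⟩

/-- Domination is preserved under convex combinations, so mixing the laws of `Z` under `P` and `P'`
interpolates between the two means. -/
lemma exists_dominated_mean (hZ : Z ∈ S.H) (h : S.tail Z 0 ≠ ⊤) {P P' : S.Prob}
    (hP : P ∈ S.maxFamily) (hP' : P' ∈ S.maxFamily) {l : ℝ} (hl : l ∈ Set.Icc (0 : ℝ) 1) :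
    ∃ p : Measure ℝ, IsProbabilityMeasure p ∧ S.Dominated Z p ∧ Integrable (fun t => t) p ∧
      ∫ t, t ∂p = (1 - l) * ∫ ω, Z ω ∂(P : @Measure Ω S.sigma)
        + l * ∫ ω, Z ω ∂(P' : @Measure Ω S.sigma) := by
  have hm := measurable_sigma hZ
  let law : S.Prob → Measure ℝ := fun P =>
    @Measure.map _ _ S.sigma _ Z (P : @Measure Ω S.sigma)
  have hlaw : ∀ P, IsProbabilityMeasure (law P) := fun P =>
    Measure.isProbabilityMeasure_map hm.aemeasurable
  have hint : ∀ P ∈ S.maxFamily, Integrable (fun t => t) (law P) := fun P hP =>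
    (integrable_map_measure aestronglyMeasurable_id hm.aemeasurable).2
      (integrable_of_tail hZ h hP)
  have hval : ∀ P, ∫ t, t ∂(law P) = ∫ ω, Z ω ∂(P : @Measure Ω S.sigma) := fun P =>
    integral_map (f := fun t => t) hm.aemeasurable aestronglyMeasurable_id
  have hl0 : 0 ≤ 1 - l := by linarith [hl.2]
  let p : Measure ℝ := ENNReal.ofReal (1 - l) • law P + ENNReal.ofReal l • law P'
  have hmix : ∀ f : ℝ → ℝ, Integrable f (law P) → Integrable f (law P') →
      ∫ t, f t ∂p = (1 - l) * ∫ t, f t ∂(law P) + l * ∫ t, f t ∂(law P') := fun f h1 h2 => by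
    rw [integral_add_measure (h1.smul_measure ENNReal.ofReal_ne_top)
      (h2.smul_measure ENNReal.ofReal_ne_top), integral_smul_measure, integral_smul_measure,
      ENNReal.toReal_ofReal hl0, ENNReal.toReal_ofReal hl.1, smul_eq_mul, smul_eq_mul]
  refine ⟨p, ⟨?_⟩, fun φ hφ => ?_, ?_, ?_⟩
  · simp only [p, Measure.add_apply, Measure.smul_apply, measure_univ, smul_eq_mul, mul_one]
    rw [← ENNReal.ofReal_add hl0 hl.1]
    simp
  · have hi : ∀ P, Integrable φ (law P) := fun P =>
      integrable_of_bdd hφ.1.choose_spec.continuous.measurable hφ.2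
    rw [hmix φ (hi P) (hi P')]
    have h1 := law_dominated hZ hP φ hφ
    have h2 := law_dominated hZ hP' φ hφ
    calc _ ≤ (1 - l) * S.ev (fun ω => φ (Z ω)) + l * S.ev (fun ω => φ (Z ω)) :=
          add_le_add (mul_le_mul_of_nonneg_left h1 hl0) (mul_le_mul_of_nonneg_left h2 hl.1)
      _ = _ := by ring
  · exact ((hint P hP).smul_measure ENNReal.ofReal_ne_top).add_measure
      ((hint P' hP').smul_measure ENNReal.ofReal_ne_top)
  · rw [hmix _ (hint P hP) (hint P' hP'), hval, hval]

end mean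

end SublinearExpectation

/-! ### A law of large numbers uniform in the target mean. -/

section lln

lemma exists_forall_abs_sum_sub_le {y : ℕ → ℝ} {a ε : ℝ} (hε : 0 < ε)
    (h : Tendsto (fun n : ℕ => (∑ i ∈ Finset.range n, y i) / n) atTop (𝓝 a)) :
    ∃ M : ℕ, ∀ j : ℕ, |∑ i ∈ Finset.range j, y i - j * a| ≤ ε * (M + j) := by
  obtain ⟨N, hN⟩ := Metric.tendsto_atTop.1 h ε hε
  obtain ⟨M, hM⟩ := exists_nat_ge
    ((∑ j ∈ Finset.range N, |∑ i ∈ Finset.range j, y i - j * a|) / ε)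
  refine ⟨M, fun j => ?_⟩
  rw [div_le_iff₀ hε] at hM
  rcases lt_or_ge j N with hj | hj
  · have h1 := Finset.single_le_sum (f := fun j : ℕ => |∑ i ∈ Finset.range j, y i - j * a|)
      (fun _ _ => abs_nonneg _) (Finset.mem_range.2 hj)
    have h2 : 0 ≤ ε * j := by positivity
    linarith
  · rcases Nat.eq_zero_or_pos j with rfl | hpos
    · simp only [Finset.range_zero, Finset.sum_empty, Nat.cast_zero, zero_mul, sub_zero, abs_zero]
      positivity
    · have hj0 : (0 : ℝ) < j := by exact_mod_cast hpos
      have h1 := (hN j hj).le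
      rw [Real.dist_eq, show (∑ i ∈ Finset.range j, y i) / (j : ℝ) - a =
        (∑ i ∈ Finset.range j, y i - j * a) / j by field_simp, abs_div, abs_of_pos hj0,
        div_le_iff₀ hj0] at h1
      have h2 : 0 ≤ ε * M := by positivity
      linarith

/-- The event that the partial sums of `y` deviate from the line of slope `a`. -/
def deviation (a ε : ℝ) (m : ℕ) : Set (ℕ → ℝ) :=
  {y | ∃ j : ℕ, ε * (m + j) < |∑ i ∈ Finset.range j, y i - j * a|}

lemma measurableSet_deviation (a ε : ℝ) (m : ℕ) : MeasurableSet (deviation a ε m) := by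
  have : deviation a ε m =
      ⋃ j : ℕ, {y | ε * (m + j) < |∑ i ∈ Finset.range j, y i - j * a|} := by
    ext y; simp [deviation]
  rw [this]
  exact MeasurableSet.iUnion fun j => measurableSet_lt (by fun_prop) (by fun_prop)

/-- The events decrease in `m`, and by the strong law their intersection is null. All `j` are
controlled at once, so the length of the block after `m` plays no role. -/
lemma exists_forall_deviation_le (p : Measure ℝ) [IsProbabilityMeasure p]
    (hp : Integrable (fun t => t) p) {ε : ℝ} (hε : 0 < ε) {δ : ℝ≥0∞} (hδ : 0 < δ) :
    ∃ M : ℕ, ∀ m ≥ M,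
      (Measure.infinitePi fun _ : ℕ => p) (deviation (∫ t, t ∂p) ε m) ≤ δ := by
  set ν := Measure.infinitePi fun _ : ℕ => p
  have hmp : ∀ i : ℕ, MeasurePreserving (fun y : ℕ → ℝ => y i) ν p := fun i =>
    measurePreserving_eval_infinitePi (fun _ : ℕ => p) i
  have hsl := ProbabilityTheory.strong_law_ae_real (μ := ν) (fun i (y : ℕ → ℝ) => y i)
    ((hmp 0).integrable_comp_of_integrable hp)
    (fun i j hij => (ProbabilityTheory.iIndepFun_infinitePi (P := fun _ : ℕ => p)
      (X := fun _ t => t) (fun _ => measurable_id)).indepFun hij)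
    (fun i => ⟨(measurable_pi_apply i).aemeasurable, (measurable_pi_apply 0).aemeasurable, (hmp i).map_eq.trans (hmp 0).map_eq.symm⟩)
  have hmean : ∫ y, y 0 ∂ν = ∫ t, t ∂p := by
    have h := integral_map (μ := ν) (φ := fun y : ℕ → ℝ => y 0) (f := fun t : ℝ => t)
      (hmp 0).measurable.aemeasurable aestronglyMeasurable_id
    rw [(hmp 0).map_eq] at h
    exact h.symm
  have hanti : Antitone (deviation (∫ t, t ∂p) ε) := fun m n hmn y ⟨j, hj⟩ =>
    ⟨j, lt_of_le_of_lt (by gcongr) hj⟩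
  have hnull : ν (⋂ m, deviation (∫ t, t ∂p) ε m) = 0 := by
    refine measure_mono_null (fun y hy => ?_) (ae_iff.1 hsl)
    intro hlim
    obtain ⟨M, hM⟩ := exists_forall_abs_sum_sub_le hε hlim
    obtain ⟨j, hj⟩ := Set.mem_iInter.1 hy M
    rw [← hmean] at hj
    exact absurd (hM j) (not_le.2 hj)
  have ht := tendsto_measure_iInter_atTop (μ := ν)
    (fun m => (measurableSet_deviation (∫ t, t ∂p) ε m).nullMeasurableSet) hanti
    ⟨0, measure_ne_top _ _⟩
  rw [hnull] at ht
  exact eventually_atTop.1 (ht.eventually_le_const hδ)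

/-- A law of large numbers, uniform over a compact interval of means. -/
lemma exists_uniform_deviation_le {D : Measure ℝ → Prop} {lo up : ℝ}
    (hD : ∀ a ∈ Set.Icc lo up, ∀ ε > 0, ∃ p : Measure ℝ, IsProbabilityMeasure p ∧ D p ∧
      Integrable (fun t => t) p ∧ |∫ t, t ∂p - a| ≤ ε)
    {ε : ℝ} (hε : 0 < ε) {δ : ℝ≥0∞} (hδ : 0 < δ) :
    ∃ M : ℕ, ∀ m ≥ M, ∀ a ∈ Set.Icc lo up, ∃ p : Measure ℝ, IsProbabilityMeasure p ∧ D p ∧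
      (Measure.infinitePi fun _ : ℕ => p) (deviation a ε m) ≤ δ := by
  have hε3 : 0 < ε / 3 := by positivity
  have h1 : ∀ a ∈ Set.Icc lo up, ∃ M : ℕ, ∃ p : Measure ℝ, IsProbabilityMeasure p ∧ D p ∧
      |∫ t, t ∂p - a| ≤ ε / 3 ∧ ∀ m ≥ M,
        (Measure.infinitePi fun _ : ℕ => p) (deviation (∫ t, t ∂p) (ε / 3) m) ≤ δ := by
    intro a ha
    obtain ⟨p, hp, hDp, hint, hmean⟩ := hD a ha (ε / 3) hε3
    obtain ⟨M, hM⟩ := exists_forall_deviation_le p hint hε3 hδ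
    exact ⟨M, p, hp, hDp, hmean, hM⟩
  choose! M p hp hDp hmean hM using h1
  -- The law found for `b` serves all `a` within `ε / 3` of `b`: one third of `ε` is spent on the
  -- deviation, one on the mean of `p b`, one on `|a - b|`.
  obtain ⟨t, ht, hcov⟩ := (isCompact_Icc (a := lo) (b := up)).elim_nhds_subcover
    (fun a => Metric.ball a (ε / 3)) fun a _ => Metric.ball_mem_nhds a hε3
  refine ⟨t.sup M, fun m hm a ha => ?_⟩
  obtain ⟨b, hbt, hab⟩ := Set.mem_iUnion₂.1 (hcov ha)
  have hb := ht b hbt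
  refine ⟨p b, hp b hb, hDp b hb, (measure_mono ?_).trans
    (hM b hb m ((Finset.le_sup hbt).trans hm))⟩
  rintro y ⟨j, hj⟩
  refine ⟨j, ?_⟩
  have e1 : |∑ i ∈ Finset.range j, y i - j * a| ≤
      |∑ i ∈ Finset.range j, y i - j * ∫ t, t ∂(p b)| + j * |∫ t, t ∂(p b) - a| := by
    rw [← abs_of_nonneg (Nat.cast_nonneg (α := ℝ) j), ← abs_mul,
      abs_of_nonneg (Nat.cast_nonneg (α := ℝ) j)]
    refine le_trans (le_of_eq ?_) (abs_add_le _ _)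
    congr 1
    ring
  have e2 : |∫ t, t ∂(p b) - a| ≤ ε / 3 + ε / 3 := by
    rw [Metric.mem_ball, Real.dist_eq, abs_sub_comm] at hab
    have := abs_sub_le (∫ t, t ∂(p b)) b a
    linarith [hmean b hb]
  have e3 := mul_le_mul_of_nonneg_left e2 (Nat.cast_nonneg (α := ℝ) j)
  have e4 : 0 ≤ ε * m := by positivity
  nlinarith

end lln

/-! ### Lipschitz penalties for missing the target on a block. -/

section penalty

/-- A penalty in `[0, 1]` which vanishes if on the block `[m, n)` the sequence follows the mean
`a` up to `ε`. -/
noncomputable def blockPenalty (m n : ℕ) (ε : ℝ) (a : (ℕ → ℝ) → ℝ) (x : ℕ → ℝ) : ℝ :=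
  min 1 (∑ k ∈ Finset.Icc m n,
    max 0 ((ε * k)⁻¹ * |∑ i ∈ Finset.Ico m k, x i - ((k - m : ℕ) : ℝ) * a x| - 1))

variable {m n : ℕ} {ε : ℝ} {a : (ℕ → ℝ) → ℝ}

lemma blockPenalty_mem_Icc (x : ℕ → ℝ) : blockPenalty m n ε a x ∈ Set.Icc (0 : ℝ) 1 :=
  ⟨le_min zero_le_one (Finset.sum_nonneg fun _ _ => le_max_left _ _), min_le_left _ _⟩

lemma isCylLip_blockPenalty (hmn : m ≤ n) (ha : IsCylLip m a) :
    IsCylLip n (blockPenalty m n ε a) := by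
  refine IsCylLip.min_const (IsCylLip.sum _ fun k hk => IsCylLip.max_const (IsCylLip.sub
    (IsCylLip.const_mul (IsCylLip.abs (IsCylLip.sub (IsCylLip.sum _ fun i hi =>
      IsCylLip.coord ?_) (IsCylLip.const_mul (ha.mono hmn) _))) _) (IsCylLip.const 1)) 0) 1
  exact (Finset.mem_Ico.1 hi).2.trans_le (Finset.mem_Icc.1 hk).2

/-- The factor `2` pays for continuity: each summand is `0` up to deviation `ε * k` and reaches `1`
at `2 * ε * k`. -/
lemma le_of_blockPenalty_lt_one (hm : 1 ≤ m) (hε : 0 < ε) {x : ℕ → ℝ}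
    (h : blockPenalty m n ε a x < 1) {k : ℕ} (hk : k ∈ Finset.Icc m n) :
    |∑ i ∈ Finset.Ico m k, x i - ((k - m : ℕ) : ℝ) * a x| ≤ 2 * ε * k := by
  have hk0 : (0 : ℝ) < k := by
    have := (Finset.mem_Icc.1 hk).1
    exact_mod_cast (show 0 < k by omega)
  have h1 := (min_lt_iff.1 h).resolve_left (lt_irrefl _)
  have h2 := (Finset.single_le_sum (f := fun k : ℕ => max 0
    ((ε * k)⁻¹ * |∑ i ∈ Finset.Ico m k, x i - ((k - m : ℕ) : ℝ) * a x| - 1))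
    (fun _ _ => le_max_left _ _) hk).trans_lt h1
  have h3 := (le_max_right _ _).trans_lt h2
  have h4 : (ε * k)⁻¹ * |∑ i ∈ Finset.Ico m k, x i - ((k - m : ℕ) : ℝ) * a x| < 2 := by linarith
  rw [inv_mul_lt_iff₀ (by positivity)] at h4
  linarith

/-- Off the deviation event every summand is zero, so the penalty is below the indicator of that
event. The target `a` depends only on the past and is constant along the splice. -/
lemma integral_blockPenalty_le (hm : 1 ≤ m) (hε : 0 < ε) (hmn : m ≤ n) (ha : IsCylLip m a)
    {p : Measure ℝ} [IsProbabilityMeasure p] {δ : ℝ} (hδ : 0 ≤ δ) (x : ℕ → ℝ)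
    (h : (Measure.infinitePi fun _ : ℕ => p) (deviation (a x) ε m) ≤ ENNReal.ofReal δ) :
    ∫ y, blockPenalty m n ε a (SublinearExpectation.splice m x y)
      ∂(Measure.infinitePi fun _ : ℕ => p) ≤ δ := by
  have hle : ∀ y, blockPenalty m n ε a (SublinearExpectation.splice m x y) ≤
      (deviation (a x) ε m).indicator (fun _ => (1 : ℝ)) y := by
    intro y
    by_cases hy : y ∈ deviation (a x) ε m
    · rw [Set.indicator_of_mem hy]
      exact min_le_left _ _
    · rw [Set.indicator_of_notMem hy]
      refine (min_le_right _ _).trans (Finset.sum_nonpos fun k hk => max_le le_rfl ?_)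
      have hk1 := (Finset.mem_Icc.1 hk).1
      have hk0 : (0 : ℝ) < k := by exact_mod_cast (show 0 < k by omega)
      have e1 : a (SublinearExpectation.splice m x y) = a x :=
        ha.congr fun i hi => by simp [SublinearExpectation.splice, hi]
      have e2 : ∑ i ∈ Finset.Ico m k, SublinearExpectation.splice m x y i =
          ∑ i ∈ Finset.range (k - m), y i := by
        rw [Finset.sum_Ico_eq_sum_range]
        exact Finset.sum_congr rfl fun i _ => by simp [SublinearExpectation.splice]
      have e3 : |∑ i ∈ Finset.range (k - m), y i - ((k - m : ℕ) : ℝ) * a x| ≤ ε * k := by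
        have := not_lt.1 (not_exists.1 hy (k - m))
        rwa [← Nat.cast_add, Nat.add_sub_cancel' hk1] at this
      rw [e1, e2, sub_nonpos, inv_mul_le_iff₀ (by positivity), mul_one]
      exact e3
  have hmeas := measurableSet_deviation (a x) ε m
  have hint : Integrable (fun y => blockPenalty m n ε a (SublinearExpectation.splice m x y))
      (Measure.infinitePi fun _ : ℕ => p) :=
    SublinearExpectation.integrable_of_bdd ((isCylLip_blockPenalty hmn ha).measurable.comp
      (SublinearExpectation.measurable_splice m x))
      (IsBdd.of_mem_Icc fun y => blockPenalty_mem_Icc _)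
  refine (integral_mono hint ((integrable_const 1).indicator hmeas) hle).trans ?_
  rw [integral_indicator_const _ hmeas, smul_eq_mul, mul_one]
  exact ENNReal.toReal_le_of_le_ofReal hδ h

end penalty

lemma ae_tendsto_zero_of_sum_lintegral_le {α : Type*} {mα : MeasurableSpace α} {μ : Measure α}
    {f : ℕ → α → ℝ} (hf : ∀ k, Measurable (f k)) {C : ℝ≥0∞} (hC : C ≠ ⊤)
    (h : ∀ K, ∑ k ∈ Finset.range K, ∫⁻ x, ENNReal.ofReal |f k x| ∂μ ≤ C) :
    ∀ᵐ x ∂μ, Tendsto (fun k => f k x) atTop (𝓝 0) := by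
  have hm : ∀ k, Measurable fun x => ENNReal.ofReal |f k x| := fun k =>
    ENNReal.measurable_ofReal.comp (measurable_norm.comp (hf k))
  have h1 : ∫⁻ x, ∑' k, ENNReal.ofReal |f k x| ∂μ ≠ ⊤ := by
    rw [lintegral_tsum fun k => (hm k).aemeasurable]
    exact ne_top_of_le_ne_top hC (ENNReal.tsum_le_of_sum_range_le h)
  filter_upwards [ae_lt_top (Measurable.tsum hm) h1] with x hx
  have h2 := (ENNReal.tendsto_toReal ENNReal.zero_ne_top).comp
    (ENNReal.tendsto_atTop_zero_of_tsum_ne_top hx.ne)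
  rw [tendsto_zero_iff_abs_tendsto_zero]
  refine h2.congr fun k => ?_
  simp [Function.comp, ENNReal.toReal_ofReal (abs_nonneg _)]

/-! ### One measure for all penalties. -/

namespace SublinearExpectation

variable {Ω : Type*} [MeasurableSpace Ω] {S : SublinearExpectation Ω} {Ps : Set S.Prob}
  {X : ℕ → Ω → ℝ}

lemma ev_sub_sum_penalty_ge (hX : S.IsIID X) {n : ℕ → ℕ} (hn : Monotone n) (hn0 : 1 ≤ n 0)
    {g : ℕ → (ℕ → ℝ) → ℝ} (hg : ∀ k, IsCylLip (n (k + 1)) (g k)) (hgb : ∀ k, IsBdd (g k))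
    {δ : ℕ → ℝ}
    (hpen : ∀ k x, ∃ p : Measure ℝ, IsProbabilityMeasure p ∧ S.Dominated (X 0) p ∧
      ∫ y, g k (splice (n k) x y) ∂(Measure.infinitePi fun _ : ℕ => p) ≤ δ k)
    {f : (ℕ → ℝ) → ℝ} (hf : IsCylLip (n 0) f) (hfb : IsBdd f) (K : ℕ) :
    S.ev (fun ω => f fun i => X i ω) - ∑ k ∈ Finset.range K, δ k ≤
      S.ev (fun ω => f (fun i => X i ω) - ∑ k ∈ Finset.range K, g k fun i => X i ω) := by
  induction K with
  | zero => simp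
  | succ K ih =>
    have h1 := ev_sub_penalty_ge hX (hn0.trans (hn (Nat.zero_le K))) (hn (Nat.le_succ K))
      (f := fun x => f x - ∑ k ∈ Finset.range K, g k x) (g := g K)
      ((hf.mono (hn (Nat.zero_le K))).sub (IsCylLip.sum _ fun k hk =>
        (hg k).mono (hn (Finset.mem_range.1 hk))))
      (hfb.sub (IsBdd.sum _ fun k _ => hgb k)) (hg K) (hgb K) (hpen K)
    simp only [Finset.sum_range_succ]
    simp only [← sub_sub]
    linarith

/-- Penalties which are small under suitable dominated kernels are all small under a single
member of `Ps`. -/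
lemma exists_integral_penalty_le (hCC : S.ConditionCC Ps) (hX : S.IsIID X) {n : ℕ → ℕ}
    (hn : Monotone n) (hn0 : 1 ≤ n 0) {g : ℕ → (ℕ → ℝ) → ℝ}
    (hg : ∀ k, IsCylLip (n (k + 1)) (g k)) (hg01 : ∀ k x, g k x ∈ Set.Icc (0 : ℝ) 1)
    (hpen : ∀ k x, ∃ p : Measure ℝ, IsProbabilityMeasure p ∧ S.Dominated (X 0) p ∧
      ∫ y, g k (splice (n k) x y) ∂(Measure.infinitePi fun _ : ℕ => p) ≤ (1 / 2) ^ k)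
    {H : ℕ → (ℕ → ℝ) → ℝ} (hH : ∀ K, IsCylLip (n 0) (H K)) (hHb : ∀ K, IsBdd (H K))
    (hHmono : ∀ x, Monotone fun K => H K x) {C : ℝ}
    (hC : ∀ K, -C ≤ S.ev (fun ω => -H K fun i => X i ω)) :
    ∃ P ∈ Ps, ∀ K, ∫ ω, (H K (fun i => X i ω) + ∑ k ∈ Finset.range K, g k fun i => X i ω)
      ∂(P : @Measure Ω S.sigma) ≤ C + 3 := by
  have hgb : ∀ k, IsBdd (g k) := fun k => IsBdd.of_mem_Icc (hg01 k)
  have hG : ∀ K, IsCylLip (n K) fun x => H K x + ∑ k ∈ Finset.range K, g k x := fun K =>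
    ((hH K).mono (hn (Nat.zero_le K))).add (IsCylLip.sum _ fun k hk =>
        (hg k).mono (hn (Finset.mem_range.1 hk)))
  have hGb : ∀ K, IsBdd fun x => H K x + ∑ k ∈ Finset.range K, g k x := fun K =>
    (hHb K).add (IsBdd.sum _ fun k _ => hgb k)
  have hmem := fun K => S.cyl_mem_Hb (hG K) (hGb K) hX.mem
  refine exists_forall_integral_le hCC (c := fun _ => C + 3) hmem fun K => ?_
  have h1 := ev_sub_sum_penalty_ge hX hn hn0 hg hgb hpen (hH K).neg (hHb K).neg K
  have h2 : ∑ k ∈ Finset.range K, (1 / 2 : ℝ) ^ k ≤ 2 := sum_geometric_two_le K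
  have h3 := hC K
  have e : (fun ω => -H K (fun i => X i ω) - ∑ k ∈ Finset.range K, g k fun i => X i ω) =
      fun ω => -(H K (fun i => X i ω) + ∑ k ∈ Finset.range K, g k fun i => X i ω) := by
    funext ω; ring
  rw [e] at h1
  -- The expectation is at least `-C - 2`: `C` for `H`, `2` for the geometric series. The third unit
  -- makes the inequality strict, so that it is realised by a measure. As the total penalty
  -- increases with `K`, the bound at `K` covers all `k ≤ K`.
  obtain ⟨P, hP, hlt⟩ := exists_lt_integral hCC (S.neg_mem_Hb (hmem K)) (c := -(C + 3)) (by linarith)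
  rw [integral_neg] at hlt
  refine ⟨P, hP, fun k hk => le_trans (integral_mono (integrable_Hb (hmem k) P)
    (integrable_Hb (hmem K) P) fun ω => add_le_add (hHmono _ hk) ?_) (neg_lt_neg_iff.1 hlt).le⟩
  exact Finset.sum_le_sum_of_subset_of_nonneg (Finset.range_mono hk) fun i _ _ => (hg01 i _).1

end SublinearExpectation

/-! ### Cluster sets of running averages along fast growing blocks. -/

section deterministic

lemma exists_dense_sequence : ∃ q : ℕ → ℝ, (∀ k, q k ∈ Set.Icc (0 : ℝ) 1) ∧
    ∀ t ∈ Set.Icc (0 : ℝ) 1, MapClusterPt t atTop q := by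
  refine ⟨fun k => TopologicalSpace.denseSeq unitInterval k.unpair.1, fun k => Subtype.prop _,
    fun t ht => mapClusterPt_iff_frequently.2 fun U hU => frequently_atTop.2 fun N => ?_⟩
  obtain ⟨V, hVU, hVo, htV⟩ := mem_nhds_iff.1 hU
  obtain ⟨i, hi⟩ := (TopologicalSpace.denseRange_denseSeq unitInterval).exists_mem_open
    (hVo.preimage continuous_subtype_val) ⟨⟨t, ht⟩, htV⟩
  -- The pairing function makes each term of the dense sequence recur at arbitrarily late indices.
  exact ⟨Nat.pair i N, Nat.right_le_pair i N, hVU (by simpa using hi)⟩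

lemma tendsto_zero_of_le_half_add {u δ : ℕ → ℝ} (hu : ∀ k, 0 ≤ u k)
    (hδ : Tendsto δ atTop (𝓝 0)) (h : ∀ᶠ k in atTop, u (k + 1) ≤ u k / 2 + δ k) :
    Tendsto u atTop (𝓝 0) := by
  rw [Metric.tendsto_atTop]
  intro ε hε
  obtain ⟨N, hN⟩ := eventually_atTop.1 (h.and (hδ.eventually_lt_const (show (0 : ℝ) < ε / 4 by
    positivity)))
  have h1 : ∀ j, u (N + j) ≤ ε / 2 + (1 / 2) ^ j * u N := by
    intro j
    induction j with
    | zero => simp; linarith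
    | succ j ih =>
      have := hN (N + j) (by omega)
      rw [← add_assoc, pow_succ]
      linarith [this.1, this.2]
  have h2 : Tendsto (fun j : ℕ => (1 / 2 : ℝ) ^ j * u N) atTop (𝓝 0) := by
    simpa using (tendsto_pow_atTop_nhds_zero_of_lt_one (by norm_num : (0 : ℝ) ≤ 1 / 2)
      (by norm_num)).mul_const (u N)
  obtain ⟨J, hJ⟩ := eventually_atTop.1 (h2.eventually_lt_const (show (0 : ℝ) < ε / 2 by positivity))
  refine ⟨N + J, fun k hk => ?_⟩
  obtain ⟨j, rfl⟩ := Nat.exists_eq_add_of_le hk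
  rw [Real.dist_eq, sub_zero, abs_of_nonneg (hu _), add_assoc]
  linarith [h1 (J + j), hJ (J + j) (by omega)]

variable {x : ℕ → ℝ} {n : ℕ → ℕ} {a ε q : ℕ → ℝ} {lo up : ℝ}

/-- The average at time `k` is the convex combination, with weights `m / k` and `1 - m / k`, of the
average at `m` and the average over the block. -/
lemma abs_runningAverage_sub_le {m k : ℕ} (hm : 1 ≤ m) (hmk : m ≤ k) {a ε : ℝ}
    (h : |∑ i ∈ Finset.Ico m k, x i - ((k - m : ℕ) : ℝ) * a| ≤ ε * k) :
    |runningAverage x k - (m / k * runningAverage x m + (1 - m / k) * a)| ≤ ε := by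
  have hm0 : (0 : ℝ) < m := by exact_mod_cast hm
  have hk0 : (0 : ℝ) < k := by exact_mod_cast (show 0 < k by omega)
  have e : runningAverage x k - (m / k * runningAverage x m + (1 - m / k) * a) =
      (∑ i ∈ Finset.Ico m k, x i - ((k - m : ℕ) : ℝ) * a) / k := by
    unfold runningAverage
    rw [Finset.sum_Ico_eq_sub _ hmk, Nat.cast_sub hmk]
    field_simp
    ring
  rw [e, abs_div, abs_of_pos hk0, div_le_iff₀ hk0]
  exact h

/-- If the means `a k` followed on the blocks `[n k, n (k + 1))` sweep the interval `[lo, up]`,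
then the running averages cluster exactly at `[lo, up]`. -/
lemma clusterSet_runningAverage_eq_Icc (hlu : lo ≤ up) (hn : StrictMono n) (hn0 : 1 ≤ n 0)
    (hnk : ∀ k, (k + 1) * n k ≤ n (k + 1)) (hε : Tendsto ε atTop (𝓝 0))
    (hq : ∀ k, q k ∈ Set.Icc (0 : ℝ) 1) (hqc : ∀ t ∈ Set.Icc (0 : ℝ) 1, MapClusterPt t atTop q)
    (ha : Tendsto (fun k => a k - (lo + q k * (up - lo))) atTop (𝓝 0))
    (hdev : ∀ᶠ k in atTop, ∀ j ∈ Finset.Icc (n k) (n (k + 1)),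
      |∑ i ∈ Finset.Ico (n k) j, x i - ((j - n k : ℕ) : ℝ) * a k| ≤ ε k * j) :
    clusterSet (runningAverage x) = Set.Icc lo up := by
  have hn1 : ∀ k, 1 ≤ n k := fun k => hn0.trans (hn.monotone (Nat.zero_le k))
  set b : ℕ → ℝ := fun k => lo + q k * (up - lo) with hb
  have hbmem : ∀ k, b k ∈ Set.Icc lo up := fun k => by
    have h0 : 0 ≤ up - lo := by linarith
    constructor
    · have := mul_nonneg (hq k).1 h0
      simp only [hb]; linarith
    · have := mul_le_mul_of_nonneg_right (hq k).2 h0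
      simp only [hb]; linarith
  have hεnn : ∀ᶠ k in atTop, 0 ≤ ε k := by
    filter_upwards [hdev] with k hk
    have h1 := hk (n k) (Finset.mem_Icc.2 ⟨le_rfl, hn.monotone (Nat.le_succ k)⟩)
    have h2 : (0 : ℝ) < n k := by exact_mod_cast hn1 k
    exact nonneg_of_mul_nonneg_left ((abs_nonneg _).trans h1) h2
  -- The error at block ends contracts: the past enters with weight `r ≤ 1 / (k + 2) ≤ 1 / 2`, and
  -- the bounded jump `b k - b (k + 1)` is also multiplied by `r`, which tends to `0`.
  have hu : Tendsto (fun k => |runningAverage x (n (k + 1)) - b k|) atTop (𝓝 0) := by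
    have hd : Tendsto (fun k : ℕ => (up - lo) * (1 / (((k + 1 : ℕ) : ℝ) + 1))
        + |a (k + 1) - b (k + 1)| + ε (k + 1)) atTop (𝓝 0) := by
      have h1 := (tendsto_add_atTop_iff_nat 1).2
        (tendsto_one_div_add_atTop_nhds_zero_nat (𝕜 := ℝ))
      have h2 := (tendsto_add_atTop_iff_nat 1).2 ha.abs
      have h3 := (tendsto_add_atTop_iff_nat 1).2 hε
      simpa using ((h1.const_mul (up - lo)).add h2).add h3
    refine tendsto_zero_of_le_half_add (fun _ => abs_nonneg _) hd ?_
    filter_upwards [(tendsto_add_atTop_nat 1).eventually hdev] with k hk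
    have h1 := abs_runningAverage_sub_le (hn1 (k + 1)) (hn.monotone (Nat.le_succ _))
      (hk _ (Finset.right_mem_Icc.2 (hn.monotone (Nat.le_succ _))))
    set r : ℝ := (n (k + 1) : ℝ) / n (k + 1 + 1) with hr
    have hpos : (0 : ℝ) < n (k + 1 + 1) := by exact_mod_cast hn1 _
    have hr0 : 0 ≤ r := by positivity
    have hr1 : r ≤ 1 / (((k + 1 : ℕ) : ℝ) + 1) := by
      rw [hr, div_le_div_iff₀ hpos (by positivity)]
      have := hnk (k + 1)
      have : ((k + 1 + 1) * n (k + 1) : ℝ) ≤ n (k + 1 + 1) := by exact_mod_cast this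
      push_cast
      linarith
    have hr2 : r ≤ 1 / 2 := hr1.trans (by
      rw [div_le_div_iff₀ (by positivity) (by norm_num)]
      push_cast
      linarith [Nat.cast_nonneg (α := ℝ) k])
    have hbb : |b k - b (k + 1)| ≤ up - lo := by
      rw [abs_le]
      constructor <;> linarith [(hbmem k).1, (hbmem k).2, (hbmem (k + 1)).1, (hbmem (k + 1)).2]
    have e : runningAverage x (n (k + 1 + 1)) - b (k + 1) =
        (runningAverage x (n (k + 1 + 1)) -
          (r * runningAverage x (n (k + 1)) + (1 - r) * a (k + 1)))
        + r * (runningAverage x (n (k + 1)) - b k) + r * (b k - b (k + 1))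
        + (1 - r) * (a (k + 1) - b (k + 1)) := by ring
    rw [e]
    have t1 : |r * (runningAverage x (n (k + 1)) - b k)| ≤
        |runningAverage x (n (k + 1)) - b k| / 2 := by
      rw [abs_mul, abs_of_nonneg hr0]
      have := mul_le_mul_of_nonneg_right hr2 (abs_nonneg (runningAverage x (n (k + 1)) - b k))
      linarith
    have t2 : |r * (b k - b (k + 1))| ≤ (up - lo) * (1 / (((k + 1 : ℕ) : ℝ) + 1)) := by
      rw [abs_mul, abs_of_nonneg hr0, mul_comm]
      exact mul_le_mul hbb hr1 hr0 (by linarith)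
    have t3 : |(1 - r) * (a (k + 1) - b (k + 1))| ≤ |a (k + 1) - b (k + 1)| := by
      rw [abs_mul, abs_of_nonneg (show 0 ≤ 1 - r by linarith)]
      exact mul_le_of_le_one_left (abs_nonneg _) (by linarith)
    have t4 := abs_add_le (runningAverage x (n (k + 1 + 1)) -
          (r * runningAverage x (n (k + 1)) + (1 - r) * a (k + 1)))
          (r * (runningAverage x (n (k + 1)) - b k))
    have t5 := abs_add_le (runningAverage x (n (k + 1 + 1)) -
          (r * runningAverage x (n (k + 1)) + (1 - r) * a (k + 1))
          + r * (runningAverage x (n (k + 1)) - b k)) (r * (b k - b (k + 1)))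
    refine (abs_add_le _ _).trans ?_
    linarith
  apply Set.Subset.antisymm
  · intro c hc
    have hc : MapClusterPt c atTop (runningAverage x) := hc
    have key : ∀ η > 0, c ∈ Set.Icc (lo - η) (up + η) := by
      intro η hη
      refine isClosed_Icc.mem_of_frequently_of_tendsto (b := 𝓝 c ⊓ map (runningAverage x) atTop)
        (f := id) ?_ (tendsto_id.mono_left inf_le_left)
      have hne : (𝓝 c ⊓ map (runningAverage x) atTop).NeBot := hc
      refine Eventually.frequently (Eventually.filter_mono inf_le_right ?_)
      rw [eventually_map]
      have h1 := hu.eventually_lt_const (show (0 : ℝ) < η / 3 by positivity)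
      have h2 := ha.abs.eventually_lt_const (show |(0 : ℝ)| < η / 3 by rw [abs_zero]; positivity)
      have h3 := hε.eventually_lt_const (show (0 : ℝ) < η / 3 by positivity)
      obtain ⟨K, hK⟩ := eventually_atTop.1 (((h1.and h2).and h3).and hdev)
      filter_upwards [eventually_ge_atTop (n (K + 1))] with j hj
      -- Let `k` be the block containing `j`. The average at `j` is nearly a convex combination of
      -- the average at `n k`, close to `b (k - 1)`, and the target `a k`, close to `b k`; both lie
      -- near `[lo, up]`.
      have hex : ∃ k, j < n (k + 1) := ⟨j, (Nat.lt_succ_self j).trans_le (hn.id_le (j + 1))⟩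
      classical
      set k := Nat.find hex with hk
      have hk1 : j < n (k + 1) := Nat.find_spec hex
      have hKk : K + 1 ≤ k := by
        have := hn.lt_iff_lt.1 (hj.trans_lt hk1)
        omega
      have hk2 : n k ≤ j := by
        have h := Nat.find_min hex (m := k - 1) (by omega)
        rw [show k - 1 + 1 = k by omega] at h
        omega
      have d1 := (hK (k - 1) (by omega)).1.1.1
      rw [show k - 1 + 1 = k by omega] at d1
      have d2 := (hK k (by omega)).1.1.2
      have d3 := (hK k (by omega)).1.2
      have d4 := abs_le.1 (abs_runningAverage_sub_le (hn1 k) hk2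
        ((hK k (by omega)).2 j (Finset.mem_Icc.2 ⟨hk2, hk1.le⟩)))
      set r : ℝ := (n k : ℝ) / j
      have hj0 : (0 : ℝ) < j := by exact_mod_cast (hn1 k).trans hk2
      have hr0 : 0 ≤ r := by positivity
      have hr1 : r ≤ 1 := (div_le_one hj0).2 (by exact_mod_cast hk2)
      have d5 := abs_lt.1 d1
      have d6 := abs_lt.1 d2
      have b1 := hbmem (k - 1)
      have b2 := hbmem k
      have i1 : lo - η / 3 ≤ runningAverage x (n k) := by linarith [b1.1]
      have i2 : runningAverage x (n k) ≤ up + η / 3 := by linarith [b1.2]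
      have i3 : lo - η / 3 ≤ a k := by linarith [b2.1]
      have i4 : a k ≤ up + η / 3 := by linarith [b2.2]
      have hr1' : 0 ≤ 1 - r := by linarith
      have m1 := mul_le_mul_of_nonneg_left i1 hr0
      have m2 := mul_le_mul_of_nonneg_left i2 hr0
      have m3 := mul_le_mul_of_nonneg_left i3 hr1'
      have m4 := mul_le_mul_of_nonneg_left i4 hr1'
      constructor
      · simp only [id]; linarith [d4.1]
      · simp only [id]; linarith [d4.2]
    constructor
    · exact le_of_forall_pos_le_add fun η hη => by linarith [(key η hη).1]
    · exact le_of_forall_pos_le_add fun η hη => (key η hη).2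
  · intro c hc
    obtain ⟨t, ht, rfl⟩ : ∃ t ∈ Set.Icc (0 : ℝ) 1, lo + t * (up - lo) = c := by
      rcases hlu.eq_or_lt with rfl | hlt
      · exact ⟨0, by simp, by simpa using le_antisymm hc.1 hc.2⟩
      · have h0 : 0 < up - lo := by linarith
        refine ⟨(c - lo) / (up - lo), ⟨div_nonneg (by linarith [hc.1]) h0.le,
          (div_le_one h0).2 (by linarith [hc.2])⟩, by field_simp; ring⟩
    obtain ⟨ψ, hψ, hlim⟩ := (hqc t ht).tendsto_subseq
    have h1 : Tendsto (fun k => b (ψ k)) atTop (𝓝 (lo + t * (up - lo))) :=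
      (hlim.mul_const (up - lo)).const_add lo
    have h2 : Tendsto (fun k => runningAverage x (n (ψ k + 1)) - b (ψ k)) atTop (𝓝 0) :=
      (tendsto_zero_iff_abs_tendsto_zero _).2 (hu.comp hψ.tendsto_atTop)
    have h3 := h2.add h1
    simp only [sub_add_cancel, zero_add] at h3
    have h4 : Tendsto (fun k => n (ψ k + 1)) atTop atTop :=
      hn.tendsto_atTop.comp ((tendsto_add_atTop_nat 1).comp hψ.tendsto_atTop)
    exact (MapClusterPt.of_comp h4 h3.mapClusterPt)

end deterministic

/-! ### Lipschitz approximation by infimal convolution. -/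

section infConv

/-- The largest minorant of `ψ` that is Lipschitz with constant `c` in the first `l`
coordinates. -/
noncomputable def infConv (l : ℕ) (c : ℝ) (ψ : (ℕ → ℝ) → ℝ) (x : ℕ → ℝ) : ℝ :=
  ⨅ y, (ψ y + c * ∑ i ∈ Finset.range l, |x i - y i|)

variable {l : ℕ} {c M : ℝ} {ψ : (ℕ → ℝ) → ℝ}

lemma bddBelow_infConv (hc : 0 ≤ c) (hM : ∀ x, |ψ x| ≤ M) (l : ℕ) (x : ℕ → ℝ) :
    BddBelow (Set.range fun y => ψ y + c * ∑ i ∈ Finset.range l, |x i - y i|) := by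
  refine ⟨-M, ?_⟩
  rintro _ ⟨y, rfl⟩
  have h1 := neg_le_of_abs_le (hM y)
  have h2 : 0 ≤ c * ∑ i ∈ Finset.range l, |x i - y i| :=
    mul_nonneg hc (Finset.sum_nonneg fun _ _ => abs_nonneg _)
  simp only
  linarith

lemma infConv_le (hc : 0 ≤ c) (hM : ∀ x, |ψ x| ≤ M) (x : ℕ → ℝ) : infConv l c ψ x ≤ ψ x := by
  simpa [infConv] using ciInf_le (bddBelow_infConv hc hM l x) x

lemma abs_infConv_le (hc : 0 ≤ c) (hM : ∀ x, |ψ x| ≤ M) (x : ℕ → ℝ) :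
    |infConv l c ψ x| ≤ M := by
  refine abs_le.2 ⟨le_ciInf fun y => ?_, (infConv_le hc hM x).trans (le_of_abs_le (hM x))⟩
  have h2 : 0 ≤ c * ∑ i ∈ Finset.range l, |x i - y i| :=
    mul_nonneg hc (Finset.sum_nonneg fun _ _ => abs_nonneg _)
  linarith [neg_le_of_abs_le (hM y)]

lemma isCylLip_infConv (hc : 0 ≤ c) (hM : ∀ x, |ψ x| ≤ M) : IsCylLip l (infConv l c ψ) := by
  have key : ∀ x x' : ℕ → ℝ, infConv l c ψ x - c * ∑ i ∈ Finset.range l, |x i - x' i| ≤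
      infConv l c ψ x' := fun x x' => by
    refine le_ciInf fun y => ?_
    have h1 := ciInf_le (bddBelow_infConv hc hM l x) y
    have h2 : ∑ i ∈ Finset.range l, |x i - y i| ≤
        ∑ i ∈ Finset.range l, |x i - x' i| + ∑ i ∈ Finset.range l, |x' i - y i| := by
      rw [← Finset.sum_add_distrib]
      exact Finset.sum_le_sum fun i _ => abs_sub_le _ _ _
    have h3 := mul_le_mul_of_nonneg_left h2 hc
    unfold infConv
    linarith
  refine ⟨c, hc, fun x y => abs_le.2 ⟨?_, by linarith [key x y]⟩⟩
  have h := key y x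
  simp only [abs_sub_comm (y _) (x _)] at h
  linarith

lemma infConv_mono {l' : ℕ} {c' : ℝ} (hc : 0 ≤ c) (hcc : c ≤ c') (hl : l ≤ l')
    (hM : ∀ x, |ψ x| ≤ M) (x : ℕ → ℝ) : infConv l c ψ x ≤ infConv l' c' ψ x := by
  refine ciInf_mono (bddBelow_infConv hc hM l x) fun y => ?_
  have hc' := hc.trans hcc
  gcongr

/-- Near-minimisers `y n` satisfy `n * ∑ |x i - y n i| ≤ 2 * M + 1`, so they approach `x`, and
continuity of `ψ` along them gives the lower bound. The number `l n` of coordinates is left free to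
cover both `ℝ^d` and `ℝ^ℕ`. -/
lemma tendsto_infConv (hM : ∀ x, |ψ x| ≤ M) (l : ℕ → ℕ) (x : ℕ → ℝ)
    (hψ : ∀ y : ℕ → ℕ → ℝ, Tendsto (fun n => ∑ i ∈ Finset.range (l n), |x i - y n i|) atTop (𝓝 0) →
      Tendsto (fun n => ψ (y n)) atTop (𝓝 (ψ x))) :
    Tendsto (fun n : ℕ => infConv (l n) n ψ x) atTop (𝓝 (ψ x)) := by
  have hc : ∀ n : ℕ, (0 : ℝ) ≤ n := fun n => Nat.cast_nonneg n
  have hex : ∀ n : ℕ, ∃ y, ψ y + n * ∑ i ∈ Finset.range (l n), |x i - y i| <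
      infConv (l n) n ψ x + 1 / ((n : ℝ) + 1) := fun n =>
    exists_lt_of_ciInf_lt (lt_add_of_pos_right _ (by positivity))
  choose y hy using hex
  have hnn : ∀ n, 0 ≤ ∑ i ∈ Finset.range (l n), |x i - y n i| := fun n =>
    Finset.sum_nonneg fun _ _ => abs_nonneg _
  have hone : ∀ n : ℕ, 1 / ((n : ℝ) + 1) ≤ 1 := fun n => by
    rw [div_le_one (by positivity)]
    linarith [hc n]
  have hsum : Tendsto (fun n => ∑ i ∈ Finset.range (l n), |x i - y n i|) atTop (𝓝 0) := by
    have h1 := (tendsto_one_div_atTop_nhds_zero_nat (𝕜 := ℝ)).const_mul (2 * M + 1)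
    rw [mul_zero] at h1
    refine squeeze_zero' (Eventually.of_forall hnn) ?_ h1
    filter_upwards [eventually_gt_atTop 0] with n hn
    have hn0 : (0 : ℝ) < n := by exact_mod_cast hn
    rw [mul_one_div, le_div_iff₀ hn0, mul_comm]
    linarith [hy n, infConv_le (l := l n) (hc n) hM x, le_of_abs_le (hM x),
      neg_le_of_abs_le (hM (y n)), hone n]
  have h1 := (hψ y hsum).sub (tendsto_one_div_add_atTop_nhds_zero_nat (𝕜 := ℝ))
  rw [sub_zero] at h1
  refine tendsto_of_tendsto_of_tendsto_of_le_of_le h1 tendsto_const_nhds (fun n => ?_)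
    fun n => infConv_le (hc n) hM x
  have := mul_nonneg (hc n) (hnn n)
  simp only
  linarith [hy n]

lemma tendsto_infConv_of_continuous (hψ : Continuous ψ) (hM : ∀ x, |ψ x| ≤ M) (x : ℕ → ℝ) :
    Tendsto (fun n : ℕ => infConv n n ψ x) atTop (𝓝 (ψ x)) := by
  refine tendsto_infConv hM (fun n => n) x fun y hy => (hψ.tendsto x).comp
    (tendsto_pi_nhds.2 fun i => tendsto_iff_dist_tendsto_zero.2 ?_)
  refine squeeze_zero' (Eventually.of_forall fun _ => dist_nonneg) ?_ hy
  filter_upwards [eventually_gt_atTop i] with n hn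
  rw [Real.dist_eq, abs_sub_comm]
  exact Finset.single_le_sum (f := fun i => |x i - y n i|) (fun _ _ => abs_nonneg _)
    (Finset.mem_range.2 hn)

lemma tendsto_infConv_of_dependsOn {d : ℕ} {ψ : (Fin d → ℝ) → ℝ} (hψ : Continuous ψ)
    (hM : ∀ z, |ψ z| ≤ M) (x : ℕ → ℝ) :
    Tendsto (fun n : ℕ => infConv d n (fun x => ψ fun j : Fin d => x j) x) atTop
      (𝓝 (ψ fun j : Fin d => x j)) := by
  refine tendsto_infConv (ψ := fun x => ψ fun j : Fin d => x j) (fun x => hM _) (fun _ => d) x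
    fun y hy => (hψ.tendsto _).comp
      (tendsto_pi_nhds.2 fun i => tendsto_iff_dist_tendsto_zero.2 ?_)
  refine squeeze_zero (fun _ => dist_nonneg) (fun n => ?_) hy
  rw [Real.dist_eq, abs_sub_comm]
  exact Finset.single_le_sum (f := fun i => |x i - y n i|) (fun _ _ => abs_nonneg _)
    (Finset.mem_range.2 i.2)

end infConv

/-- Borel functions on `ℝ^d` are approximated in mean by Lipschitz functions. -/
lemma exists_cylLip_lintegral_le {d : ℕ} (p : Measure (Fin d → ℝ)) [IsProbabilityMeasure p]
    {φ : (Fin d → ℝ) → ℝ} (hφ : Measurable φ) (hφb : IsBdd φ) {ε : ℝ} (hε : 0 < ε) :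
    ∃ f, IsCylLip d f ∧ ∫⁻ z, ENNReal.ofReal |φ z - f (extendZero z)| ∂p ≤ ENNReal.ofReal ε := by
  have hint : Integrable φ p := SublinearExpectation.integrable_of_bdd hφ hφb
  obtain ⟨ψ, hψ, hψi⟩ := hint.exists_boundedContinuous_integral_sub_le (half_pos hε)
  have hM : ∀ z, |ψ z| ≤ ‖ψ‖ := fun z => ψ.norm_coe_le_norm z
  let u : ℕ → (ℕ → ℝ) → ℝ := fun n => infConv d n (fun x => ψ fun j : Fin d => x j)
  have huc : ∀ n, IsCylLip d (u n) := fun n =>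
    isCylLip_infConv (Nat.cast_nonneg n) (M := ‖ψ‖) fun x => hM _
  have hext : ∀ z : Fin d → ℝ, (fun j : Fin d => extendZero z j) = z := fun z => by
    funext j; simp [extendZero]
  have hextm := measurable_extendZero d
  have hum : ∀ n, Measurable fun z => u n (extendZero z) := fun n =>
    (huc n).measurable.comp hextm
  have hui : ∀ n, Integrable (fun z => u n (extendZero z)) p := fun n =>
    SublinearExpectation.integrable_of_bdd (hum n)
      ⟨‖ψ‖, fun z => abs_infConv_le (Nat.cast_nonneg n) (fun x => hM _) _⟩
  have hlim : Tendsto (fun n => ∫ z, |ψ z - u n (extendZero z)| ∂p) atTop (𝓝 0) := by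
    have h := tendsto_integral_of_dominated_convergence (μ := p)
      (F := fun n z => |ψ z - u n (extendZero z)|) (f := fun _ => 0) (fun _ => ‖ψ‖ + ‖ψ‖)
      (fun n => (hψi.sub (hui n)).abs.aestronglyMeasurable) (integrable_const _)
      (fun n => ae_of_all _ fun z => ?_) (ae_of_all _ fun z => ?_)
    · simpa using h
    · rw [Real.norm_eq_abs, abs_abs]
      exact (abs_sub _ _).trans (add_le_add (hM z)
        (abs_infConv_le (Nat.cast_nonneg n) (fun x => hM _) _))
    · have h1 := tendsto_infConv_of_dependsOn ψ.continuous hM (extendZero z)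
      rw [hext z] at h1
      simpa using (h1.const_sub (ψ z)).abs
  obtain ⟨n, hn⟩ := (hlim.eventually_lt_const (half_pos hε)).exists
  refine ⟨u n, huc n, ?_⟩
  have hdi : Integrable (fun z => |φ z - u n (extendZero z)|) p := (hint.sub (hui n)).abs
  rw [← ofReal_integral_eq_lintegral_ofReal hdi (ae_of_all _ fun z => abs_nonneg _)]
  refine ENNReal.ofReal_le_ofReal ?_
  calc _ ≤ ∫ z, (‖φ z - ψ z‖ + |ψ z - u n (extendZero z)|) ∂p :=
        integral_mono hdi ((hint.sub hψi).norm.add (hψi.sub (hui n)).abs)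
          fun z => abs_sub_le _ _ _
    _ = ∫ z, ‖φ z - ψ z‖ ∂p + ∫ z, |ψ z - u n (extendZero z)| ∂p :=
        integral_add (hint.sub hψi).norm (hψi.sub (hui n)).abs
    _ ≤ ε := by linarith

lemma ae_tendsto_of_lintegral_le {α : Type*} {mα : MeasurableSpace α} {μ : Measure α}
    {f : ℕ → α → ℝ} {g : α → ℝ} (hf : ∀ k, Measurable (f k)) (hg : Measurable g)
    (h : ∀ k, ∫⁻ x, ENNReal.ofReal |g x - f k x| ∂μ ≤ ENNReal.ofReal ((1 / 2) ^ k)) :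
    ∀ᵐ x ∂μ, Tendsto (fun k => f k x) atTop (𝓝 (g x)) := by
  have h1 := ae_tendsto_zero_of_sum_lintegral_le (f := fun k x => g x - f k x) (μ := μ)
    (fun k => hg.sub (hf k)) (C := ENNReal.ofReal 2) ENNReal.ofReal_ne_top fun K =>
      (Finset.sum_le_sum fun k _ => h k).trans (by
        rw [← ENNReal.ofReal_sum_of_nonneg fun k _ => by positivity]
        exact ENNReal.ofReal_le_ofReal (sum_geometric_two_le K))
  filter_upwards [h1] with x hx
  simpa using hx.const_sub (g x)

lemma exists_block_bounds (T : ℕ → ℕ) : ∃ n : ℕ → ℕ, StrictMono n ∧ (∀ k, T k ≤ n k) ∧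
    ∀ k, (k + 1) * n k ≤ n (k + 1) := by
  let n : ℕ → ℕ := fun k => Nat.rec (T 0) (fun k m => (k + 1) * m + T (k + 1) + 1) k
  have hs : ∀ k, n (k + 1) = (k + 1) * n k + T (k + 1) + 1 := fun k => rfl
  refine ⟨n, strictMono_nat_of_lt_succ fun k => ?_, fun k => ?_, fun k => ?_⟩
  · rw [hs]; nlinarith [Nat.zero_le (k * n k)]
  · cases k with
    | zero => exact le_rfl
    | succ k => rw [hs]; omega
  · rw [hs]; omega

/-! ### Approximation uniform over `Ps`. -/

namespace SublinearExpectation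

variable {Ω : Type*} [MeasurableSpace Ω] {S : SublinearExpectation Ω} {Ps : Set S.Prob}
  {X : ℕ → Ω → ℝ}

/-- A Dini argument: the gap `w n` between the upper and lower Lipschitz envelopes decreases to `0`
pointwise. If its means exceeded `ε` somewhere in `Ps` for every `n`, compactness would give one `P`
with all means at least `ε`, against dominated convergence. -/
lemma exists_cylLip_forall_lintegral_le (hCC : S.ConditionCC Ps) (hX : ∀ i, X i ∈ S.H)
    (ψ : (ℕ → ℝ) →ᵇ ℝ) {ε : ℝ} (hε : 0 < ε) :
    ∃ n f, IsCylLip n f ∧ ∀ P ∈ Ps, ∫⁻ ω, ENNReal.ofReal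
      |ψ (fun i => X i ω) - f fun i => X i ω| ∂(P : @Measure Ω S.sigma) ≤ ENNReal.ofReal ε := by
  have hM : ∀ x, |ψ x| ≤ ‖ψ‖ := fun x => ψ.norm_coe_le_norm x
  have hM' : ∀ x, |-ψ x| ≤ ‖ψ‖ := fun x => by rw [abs_neg]; exact hM x
  have hc : ∀ n : ℕ, (0 : ℝ) ≤ n := fun n => Nat.cast_nonneg n
  let u : ℕ → (ℕ → ℝ) → ℝ := fun n => infConv n n ψ
  let v : ℕ → (ℕ → ℝ) → ℝ := fun n => infConv n n fun x => -ψ x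
  let w : ℕ → (ℕ → ℝ) → ℝ := fun n x => -v n x - u n x
  have huc : ∀ n, IsCylLip n (u n) := fun n => isCylLip_infConv (hc n) hM
  have hwc : ∀ n, IsCylLip n (w n) := fun n => (isCylLip_infConv (hc n) hM').neg.sub (huc n)
  have hwM : ∀ n x, |w n x| ≤ ‖ψ‖ + ‖ψ‖ := fun n x =>
    (abs_sub _ _).trans (add_le_add (by rw [abs_neg]; exact abs_infConv_le (hc n) hM' x)
      (abs_infConv_le (hc n) hM x))
  have hwb : ∀ n, IsBdd (w n) := fun n => ⟨_, hwM n⟩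
  have hwanti : ∀ x, Antitone fun n => w n x := fun x m n h => by
    have h1 := infConv_mono (hc m) (Nat.cast_le.2 h) h hM x
    have h2 := infConv_mono (hc m) (Nat.cast_le.2 h) h hM' x
    simp only [w, u, v]
    linarith
  have hmem := fun n => S.cyl_mem_Hb (hwc n) (hwb n) hX
  have hle : ∀ n x, |ψ x - u n x| ≤ w n x := fun n x => by
    have h1 := infConv_le (l := n) (hc n) hM x
    have h2 := infConv_le (l := n) (hc n) hM' x
    rw [abs_of_nonneg (sub_nonneg.2 h1)]
    simp only [w, u, v]
    linarith
  obtain ⟨n, hn⟩ : ∃ n, ∀ P ∈ Ps, ∫ ω, w n (fun i => X i ω) ∂(P : @Measure Ω S.sigma) ≤ ε := by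
    by_contra! hcon
    obtain ⟨P, hP, hPk⟩ := exists_forall_integral_le hCC (c := fun _ => -ε)
      (fun n => S.neg_mem_Hb (hmem n)) fun K => by
        obtain ⟨P, hP, hlt⟩ := hcon K
        refine ⟨P, hP, fun k hk => ?_⟩
        rw [integral_neg, neg_le_neg_iff]
        exact hlt.le.trans (integral_mono (integrable_Hb (hmem K) P) (integrable_Hb (hmem k) P)
          fun ω => hwanti _ hk)
    have hlim : Tendsto (fun n => ∫ ω, w n (fun i => X i ω) ∂(P : @Measure Ω S.sigma)) atTop
        (𝓝 (∫ _, (0 : ℝ) ∂(P : @Measure Ω S.sigma))) := by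
      refine tendsto_integral_of_dominated_convergence (fun _ => ‖ψ‖ + ‖ψ‖)
        (fun n => (integrable_Hb (hmem n) P).aestronglyMeasurable) (integrable_const _)
        (fun n => ae_of_all _ fun ω => hwM n _) (ae_of_all _ fun ω => ?_)
      have h1 := tendsto_infConv_of_continuous ψ.continuous hM fun i => X i ω
      have h2 := tendsto_infConv_of_continuous (ψ := fun x => -ψ x) ψ.continuous.neg hM' fun i => X i ω
      have h3 := h2.neg.sub h1
      simp only [neg_neg, sub_self] at h3
      exact h3
    rw [integral_zero] at hlim
    have h1 := ge_of_tendsto' hlim fun n => (show ε ≤ _ by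
      have := hPk n
      rw [integral_neg, neg_le_neg_iff] at this
      exact this)
    linarith
  refine ⟨n, u n, huc n, fun P hP => ?_⟩
  calc _ ≤ ∫⁻ ω, ENNReal.ofReal (w n fun i => X i ω) ∂(P : @Measure Ω S.sigma) :=
        lintegral_mono fun ω => ENNReal.ofReal_le_ofReal (hle n _)
    _ = ENNReal.ofReal (∫ ω, w n (fun i => X i ω) ∂(P : @Measure Ω S.sigma)) :=
        (ofReal_integral_eq_lintegral_ofReal (integrable_Hb (hmem n) P)
          (ae_of_all _ fun ω => (abs_nonneg _).trans (hle n _))).symm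
    _ ≤ _ := ENNReal.ofReal_le_ofReal (hn P hP)

/-- Elements of `𝕃_c` are quasi-sure limits of Lipschitz functions of finitely many
coordinates. -/
lemma exists_cylLip_tendsto (hCC : S.ConditionCC Ps) (hX : ∀ i, X i ∈ S.H)
    {φ : (ℕ → ℝ) → ℝ} (hφ : φ ∈ S.Lc Ps X) :
    ∃ (d : ℕ → ℕ) (f : ℕ → (ℕ → ℝ) → ℝ), (∀ k, IsCylLip (d k) (f k)) ∧ ∀ P ∈ Ps,
      ∀ᵐ ω ∂(P : @Measure Ω S.sigma),
        Tendsto (fun k => f k fun i => X i ω) atTop (𝓝 (φ fun i => X i ω)) := by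
  have key : ∀ k : ℕ, ∃ n f, IsCylLip n f ∧ ∀ P ∈ Ps, ∫⁻ ω, ENNReal.ofReal
      |φ (fun i => X i ω) - f fun i => X i ω| ∂(P : @Measure Ω S.sigma) ≤
        ENNReal.ofReal ((1 / 2) ^ k) := fun k => by
    have hk : (0 : ℝ) < (1 / 2) ^ k / 2 := by positivity
    obtain ⟨ψ, hψ⟩ := hφ.2 (ENNReal.ofReal ((1 / 2) ^ k / 2)) (ENNReal.ofReal_pos.2 hk)
    obtain ⟨n, f, hf, hfP⟩ := exists_cylLip_forall_lintegral_le hCC hX ψ hk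
    refine ⟨n, f, hf, fun P hP => ?_⟩
    have hm1 : Measurable[S.sigma] fun ω => ENNReal.ofReal
        |φ (fun i => X i ω) - ψ fun i => X i ω| := by
      have h : Measurable fun x => ENNReal.ofReal |φ x - ψ x| :=
        ENNReal.measurable_ofReal.comp
          (measurable_norm.comp (hφ.1.sub ψ.continuous.measurable))
      exact h.comp (measurable_seq hX)
    have h1 := (le_iSup₂ (f := fun (P : S.Prob) (_ : P ∈ Ps) => ∫⁻ ω, ENNReal.ofReal
      |φ (fun i => X i ω) - ψ (fun i => X i ω)| ∂(P : @Measure Ω S.sigma)) P hP).trans hψ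
    calc _ ≤ ∫⁻ ω, (ENNReal.ofReal |φ (fun i => X i ω) - ψ fun i => X i ω| +
            ENNReal.ofReal |ψ (fun i => X i ω) - f fun i => X i ω|)
            ∂(P : @Measure Ω S.sigma) := by
          refine lintegral_mono fun ω => ?_
          rw [← ENNReal.ofReal_add (abs_nonneg _) (abs_nonneg _)]
          exact ENNReal.ofReal_le_ofReal (abs_sub_le _ _ _)
      _ ≤ ENNReal.ofReal ((1 / 2) ^ k / 2) + ENNReal.ofReal ((1 / 2) ^ k / 2) := by
          rw [lintegral_add_left hm1]
          exact add_le_add h1 (hfP P hP)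
      _ = _ := by rw [← ENNReal.ofReal_add hk.le hk.le, add_halves]
  choose d f hf hfP using key
  refine ⟨d, f, hf, fun P hP => ?_⟩
  exact @ae_tendsto_of_lintegral_le Ω S.sigma (P : @Measure Ω S.sigma)
    (fun k ω => f k fun i => X i ω) (fun ω => φ fun i => X i ω)
    (fun k => (hf k).measurable.comp (measurable_seq hX)) (hφ.1.comp (measurable_seq hX))
    fun k => hfP k P hP

end SublinearExpectation

/-! ### Construction of the measure and the two cases of the theorem. -/

namespace SublinearExpectation

variable {Ω : Type*} [MeasurableSpace Ω] {S : SublinearExpectation Ω} {Ps : Set S.Prob}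
  {X : ℕ → Ω → ℝ}

/-- The extended means are finite, and every mean between them is attained approximately by a
dominated distribution. -/
lemma exists_means (hCC : S.ConditionCC Ps) {Z : Ω → ℝ} (hZ : Z ∈ S.H)
    (hmoment : S.choquet (fun ω => |Z ω|) < ⊤) :
    ∃ lo up : ℝ, S.lowerMean Z = lo ∧ S.upperMean Z = up ∧ lo ≤ up ∧
      ∀ a ∈ Set.Icc lo up, ∀ ε > 0, ∃ p : Measure ℝ, IsProbabilityMeasure p ∧ S.Dominated Z p ∧
        Integrable (fun t => t) p ∧ |∫ t, t ∂p - a| ≤ ε := by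
  have h := tail_zero_ne_top hmoment
  have hneg : S.tail (fun ω => -Z ω) 0 ≠ ⊤ := by simpa only [tail, abs_neg] using h
  have hmax := subset_maxFamily hCC
  obtain ⟨up, hup, hup_le, hupP⟩ := exists_upperMean hCC hZ h
  obtain ⟨lo, hlo, hlo_le, hloP⟩ := exists_upperMean hCC (S.H.neg_mem hZ) hneg
  simp only [Pi.neg_apply, integral_neg] at hlo_le hloP
  have hle : -lo ≤ up := by
    obtain ⟨P, hP⟩ := nonempty_of_conditionCC hCC
    linarith [hup_le P hP, hlo_le P hP]
  refine ⟨-lo, up, ?_, hup, hle, fun a ha ε hε => ?_⟩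
  · rw [lowerMean, EReal.coe_neg, ← hlo]
    rfl
  · obtain ⟨P, hP, hP1⟩ := hloP ε hε
    obtain ⟨P', hP', hP1'⟩ := hupP ε hε
    obtain ⟨l, hl, hla⟩ : ∃ l ∈ Set.Icc (0 : ℝ) 1, (1 - l) * -lo + l * up = a := by
      have := (segment_eq_Icc hle).symm ▸ ha
      obtain ⟨s, t, hs, ht, hst, rfl⟩ := this
      exact ⟨t, ⟨ht, by linarith⟩, by rw [← hst]; simp⟩
    obtain ⟨p, hp, hdom, hint, hmean⟩ := exists_dominated_mean hZ h (hmax hP) (hmax hP') hl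
    refine ⟨p, hp, hdom, hint, ?_⟩
    rw [hmean, ← hla]
    have hl' : 0 ≤ 1 - l := by linarith [hl.2]
    have e1 := abs_le.1 hP1
    have e2 := abs_le.1 hP1'
    have m1 := mul_le_mul_of_nonneg_left e1.1 hl'
    have m2 := mul_le_mul_of_nonneg_left e1.2 hl'
    have m3 := mul_le_mul_of_nonneg_left e2.1 hl.1
    have m4 := mul_le_mul_of_nonneg_left e2.2 hl.1
    rw [abs_le]
    constructor <;> linarith

/-- Under some member of `Ps` the running averages cluster exactly at the intervals described by
the limits of given Lipschitz functions, and given penalties depending on the first coordinates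
are under control. -/
theorem exists_prob_clusterSet (hCC : S.ConditionCC Ps) (hX : S.IsIID X)
    (hmoment : S.choquet (fun ω => |X 0 ω|) < ⊤) {d d' : ℕ → ℕ} {f f' : ℕ → (ℕ → ℝ) → ℝ}
    (hf : ∀ k, IsCylLip (d k) (f k)) (hf' : ∀ k, IsCylLip (d' k) (f' k))
    {D : ℕ} {H : ℕ → (ℕ → ℝ) → ℝ} (hH : ∀ K, IsCylLip D (H K)) (hHb : ∀ K, IsBdd (H K))
    (hH0 : ∀ K x, 0 ≤ H K x) (hHmono : ∀ x, Monotone fun K => H K x) {C : ℝ}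
    (hC : ∀ K, -C ≤ S.ev (fun ω => -H K fun i => X i ω)) :
    ∃ P ∈ Ps, (∀ K, ∫ ω, H K (fun i => X i ω) ∂(P : @Measure Ω S.sigma) ≤ C + 3) ∧
      ∀ᵐ ω ∂(P : @Measure Ω S.sigma), ∀ lo up : ℝ, S.lowerMean (X 0) ≤ (lo : EReal) → lo ≤ up →
        (up : EReal) ≤ S.upperMean (X 0) →
        Tendsto (fun k => f k fun i => X i ω) atTop (𝓝 lo) →
        Tendsto (fun k => f' k fun i => X i ω) atTop (𝓝 up) →
        clusterSet (runningAverage fun i => X i ω) = Set.Icc lo up := by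
  obtain ⟨lo, up, hlo, hup, hle, hmeans⟩ := exists_means hCC (hX.mem 0) hmoment
  obtain ⟨q, hq, hqc⟩ := exists_dense_sequence
  have hεpos : ∀ k : ℕ, (0 : ℝ) < 1 / ((k : ℝ) + 1) := fun k => by positivity
  choose M hM using fun k : ℕ => exists_uniform_deviation_le hmeans (hεpos k)
    (δ := ENNReal.ofReal ((1 / 2) ^ k)) (ENNReal.ofReal_pos.2 (by positivity))
  -- Block `k` starts after the law of large numbers has set in at accuracy `1 / (k + 1)`, and after
  -- all coordinates read by `f k`, `f' k` and `H`.
  obtain ⟨n, hn, hTn, hnk⟩ := exists_block_bounds fun k => M k + d k + d' k + D + 1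
  have hn1 : ∀ k, 1 ≤ n k := fun k => le_trans (by omega) (hTn k)
  -- The approximations may leave `[lo, up]`, where no dominated law has the right mean. Clipping is
  -- harmless in the limit, since the limiting targets lie in `[lo, up]`.
  let a : ℕ → (ℕ → ℝ) → ℝ := fun k x => max lo (min up (f k x + q k * (f' k x - f k x)))
  have hac : ∀ k, IsCylLip (n k) (a k) := fun k => by
    have h1 := (hf k).mono (show d k ≤ n k from le_trans (by omega) (hTn k))
    have h2 := (hf' k).mono (show d' k ≤ n k from le_trans (by omega) (hTn k))
    exact ((h1.add ((h2.sub h1).const_mul (q k))).min_const up).max_const lo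
  have hamem : ∀ k x, a k x ∈ Set.Icc lo up := fun k x =>
    ⟨le_max_left _ _, max_le hle (min_le_left _ _)⟩
  let g : ℕ → (ℕ → ℝ) → ℝ := fun k => blockPenalty (n k) (n (k + 1)) (1 / ((k : ℝ) + 1)) (a k)
  have hg : ∀ k, IsCylLip (n (k + 1)) (g k) := fun k =>
    isCylLip_blockPenalty (hn.monotone (Nat.le_succ k)) (hac k)
  have hg01 : ∀ k x, g k x ∈ Set.Icc (0 : ℝ) 1 := fun k x => blockPenalty_mem_Icc x
  have hpen : ∀ k x, ∃ p : Measure ℝ, IsProbabilityMeasure p ∧ S.Dominated (X 0) p ∧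
      ∫ y, g k (splice (n k) x y) ∂(Measure.infinitePi fun _ : ℕ => p) ≤ (1 / 2) ^ k := by
    intro k x
    obtain ⟨p, hp, hdom, hdev⟩ := hM k (n k) (le_trans (by omega) (hTn k)) (a k x) (hamem k x)
    exact ⟨p, hp, hdom, integral_blockPenalty_le (hn1 k) (hεpos k) (hn.monotone (Nat.le_succ k))
      (hac k) (by positivity) x hdev⟩
  obtain ⟨P, hP, hPle⟩ := exists_integral_penalty_le hCC hX hn.monotone (hn1 0) hg hg01 hpen
    (fun K => (hH K).mono (le_trans (by omega) (hTn 0))) hHb hHmono hC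
  have hHi : ∀ K, Integrable (fun ω => H K fun i => X i ω) (P : @Measure Ω S.sigma) := fun K =>
    integrable_Hb (S.cyl_mem_Hb (hH K) (hHb K) hX.mem) P
  have hgi : ∀ k, Integrable (fun ω => g k fun i => X i ω) (P : @Measure Ω S.sigma) := fun k =>
    integrable_Hb (S.cyl_mem_Hb (hg k) (IsBdd.of_mem_Icc (hg01 k)) hX.mem) P
  have hsum : ∀ K, ∫ ω, H K (fun i => X i ω) ∂(P : @Measure Ω S.sigma) +
      ∑ k ∈ Finset.range K, ∫ ω, g k (fun i => X i ω) ∂(P : @Measure Ω S.sigma) ≤ C + 3 :=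
    fun K => by
      rw [← integral_finsetSum _ fun k _ => hgi k,
        ← integral_add (hHi K) (integrable_finsetSum _ fun k _ => hgi k)]
      exact hPle K
  have hg0 : ∀ k, 0 ≤ ∫ ω, g k (fun i => X i ω) ∂(P : @Measure Ω S.sigma) := fun k =>
    integral_nonneg fun ω => (hg01 k _).1
  have hHint0 : ∀ K, 0 ≤ ∫ ω, H K (fun i => X i ω) ∂(P : @Measure Ω S.sigma) := fun K =>
    integral_nonneg fun ω => hH0 K _
  refine ⟨P, hP, fun K => ?_, ?_⟩
  · linarith [hsum K, Finset.sum_nonneg fun k (_ : k ∈ Finset.range K) => hg0 k]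
  have hlim := @ae_tendsto_zero_of_sum_lintegral_le Ω S.sigma (P : @Measure Ω S.sigma)
    (fun k ω => g k fun i => X i ω) (fun k => (hg k).measurable.comp (measurable_seq hX.mem))
    (ENNReal.ofReal (C + 3)) ENNReal.ofReal_ne_top fun K => by
      have e : ∀ k, ∫⁻ ω, ENNReal.ofReal |g k fun i => X i ω| ∂(P : @Measure Ω S.sigma) =
          ENNReal.ofReal (∫ ω, g k (fun i => X i ω) ∂(P : @Measure Ω S.sigma)) := fun k => by
        simp only [abs_of_nonneg (hg01 k _).1]
        exact (ofReal_integral_eq_lintegral_ofReal (hgi k)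
          (ae_of_all _ fun ω => (hg01 k _).1)).symm
      simp only [e]
      rw [← ENNReal.ofReal_sum_of_nonneg fun k _ => hg0 k]
      exact ENNReal.ofReal_le_ofReal (by linarith [hsum K, hHint0 K])
  filter_upwards [hlim] with ω hω l u hl hlu hu hfl hfu
  rw [hlo, EReal.coe_le_coe_iff] at hl
  rw [hup, EReal.coe_le_coe_iff] at hu
  refine clusterSet_runningAverage_eq_Icc (a := fun k => a k fun i => X i ω)
    (ε := fun k : ℕ => 2 * (1 / ((k : ℝ) + 1))) hlu hn (hn1 0) hnk ?_ hq hqc ?_ ?_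
  · simpa using (tendsto_one_div_add_atTop_nhds_zero_nat (𝕜 := ℝ)).const_mul 2
  · have h1 := (tendsto_sub_nhds_zero_iff.2 hfl).abs
    have h2 := (tendsto_sub_nhds_zero_iff.2 hfu).abs
    have h3 := (h1.const_mul 2).add h2
    simp only [abs_zero, mul_zero, add_zero] at h3
    refine (tendsto_zero_iff_abs_tendsto_zero _).2
      (squeeze_zero (fun _ => abs_nonneg _) (fun k => ?_) h3)
    set v := f k fun i => X i ω
    set v' := f' k fun i => X i ω
    have hmem1 : lo ≤ l + q k * (u - l) := by
      linarith [mul_nonneg (hq k).1 (sub_nonneg.2 hlu)]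
    have hmem2 : l + q k * (u - l) ≤ up := by
      linarith [mul_le_mul_of_nonneg_right (hq k).2 (sub_nonneg.2 hlu)]
    have hclip : l + q k * (u - l) = max lo (min up (l + q k * (u - l))) := by
      rw [min_eq_right hmem2, max_eq_right hmem1]
    have c1 : |max lo (min up (v + q k * (v' - v))) - max lo (min up (l + q k * (u - l)))| ≤
        |(v + q k * (v' - v)) - (l + q k * (u - l))| := by
      refine (abs_max_sub_max_le_max _ _ _ _).trans ?_
      rw [sub_self, abs_zero, max_eq_right (abs_nonneg _)]
      refine (abs_min_sub_min_le_max _ _ _ _).trans ?_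
      rw [sub_self, abs_zero, max_eq_right (abs_nonneg _)]
    have c2 : |(1 - q k) * (v - l)| ≤ |v - l| := by
      rw [abs_mul, abs_of_nonneg (by linarith [(hq k).2] : 0 ≤ 1 - q k)]
      exact mul_le_of_le_one_left (abs_nonneg _) (by linarith [(hq k).1])
    have c3 : |q k * (v' - u)| ≤ |v' - u| := by
      rw [abs_mul, abs_of_nonneg (hq k).1]
      exact mul_le_of_le_one_left (abs_nonneg _) (hq k).2
    have c4 : (v + q k * (v' - v)) - (l + q k * (u - l)) =
        (1 - q k) * (v - l) + q k * (v' - u) := by ring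
    have c5 := abs_add_le ((1 - q k) * (v - l)) (q k * (v' - u))
    rw [← c4] at c5
    have c6 := abs_nonneg (v - l)
    rw [← hclip] at c1
    simp only [Function.comp, a]
    linarith
  · filter_upwards [hω.eventually_lt_const zero_lt_one] with k hk j hj
    exact le_of_blockPenalty_lt_one (hn1 k) (hεpos k) hk hj

lemma measure_eq_one_of_ae {P : S.Prob} {p : Ω → Prop}
    (h : ∀ᵐ ω ∂(P : @Measure Ω S.sigma), p ω) : (P : @Measure Ω S.sigma) {ω | p ω} = 1 := by
  rw [measure_congr (eventuallyEq_univ.2 h), measure_univ]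

lemma abs_infDist_sub_le {d : ℕ} (F : Set (Fin d → ℝ)) (x y : ℕ → ℝ) :
    |Metric.infDist (fun j : Fin d => x j) F - Metric.infDist (fun j : Fin d => y j) F| ≤
      1 * ∑ i ∈ Finset.range d, |x i - y i| := by
  have h := (Metric.lipschitz_infDist_pt F).dist_le_mul (fun j : Fin d => x j) fun j => y j
  rw [Real.dist_eq, NNReal.coe_one] at h
  refine h.trans (mul_le_mul_of_nonneg_left ?_ zero_le_one)
  refine (dist_pi_le_iff (Finset.sum_nonneg fun _ _ => abs_nonneg _)).2 fun j => ?_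
  rw [Real.dist_eq]
  exact Finset.single_le_sum (f := fun i => |x i - y i|) (fun _ _ => abs_nonneg _)
    (Finset.mem_range.2 j.2)

/-- Closed sets of large probability on which an almost sure property holds. -/
lemma exists_isClosed_forall {α : Type*} [PseudoMetricSpace α] [MeasurableSpace α]
    [BorelSpace α] (p : Measure α) [IsProbabilityMeasure p] {Q : α → Prop}
    (hQ : ∀ᵐ z ∂p, Q z) : ∃ F : ℕ → Set α, (∀ j, IsClosed (F j)) ∧ (∀ j, (F j).Nonempty) ∧
      (∀ j, p.real (F j)ᶜ ≤ (1 / 2) ^ j) ∧ ∀ j, ∀ z ∈ F j, Q z := by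
  obtain ⟨A, hAQ, hAm, hA⟩ : ∃ A : Set α, (∀ z ∈ A, Q z) ∧ MeasurableSet A ∧ p Aᶜ = 0 := by
    refine ⟨(toMeasurable p {z | ¬ Q z})ᶜ, fun z hz => ?_,
      (measurableSet_toMeasurable _ _).compl, ?_⟩
    · by_contra h
      exact hz (subset_toMeasurable p _ h)
    · rw [compl_compl, measure_toMeasurable]
      exact ae_iff.1 hQ
  have key : ∀ j : ℕ, ∃ F : Set α, IsClosed F ∧ F.Nonempty ∧ p.real Fᶜ ≤ (1 / 2) ^ j ∧
      ∀ z ∈ F, Q z := fun j => by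
    have hj : (0 : ℝ) < (1 / 2) ^ j := by positivity
    have hj1 : ((1 : ℝ) / 2) ^ j ≤ 1 := pow_le_one₀ (by norm_num) (by norm_num)
    obtain ⟨F, hFA, hF, hlt⟩ := hAm.exists_isClosed_sdiff_lt (measure_ne_top p A)
      (ENNReal.ofReal_pos.2 hj).ne'
    have hlt' : p Fᶜ < ENNReal.ofReal ((1 / 2) ^ j) := by
      refine lt_of_le_of_lt ?_ hlt
      calc p Fᶜ ≤ p (Aᶜ ∪ A \ F) := measure_mono fun z hz => by
            by_cases h : z ∈ A
            · exact Or.inr ⟨h, hz⟩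
            · exact Or.inl h
        _ ≤ p Aᶜ + p (A \ F) := measure_union_le _ _
        _ = _ := by rw [hA, zero_add]
    refine ⟨F, hF, ?_, ENNReal.toReal_le_of_le_ofReal hj.le hlt'.le, fun z hz => hAQ z (hFA hz)⟩
    -- The strict bound matters for `j = 0`: an empty `F` would give `1 < (1 / 2) ^ j`. Nonemptiness
    -- is needed because the distance to the empty set is `0` by convention.
    by_contra hne
    rw [Set.not_nonempty_iff_eq_empty.1 hne, Set.compl_empty, measure_univ] at hlt'
    exact absurd (hlt'.trans_le (ENNReal.ofReal_le_ofReal hj1)) (by simp)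
  choose F h1 h2 h3 h4 using key
  exact ⟨F, h1, h2, h3, h4⟩

/-- The penalty for the first `d` coordinates being outside of `F`. -/
noncomputable def distPenalty {d : ℕ} (F : Set (Fin d → ℝ)) (K : ℕ) (x : ℕ → ℝ) : ℝ :=
  min 1 (K * Metric.infDist (fun j : Fin d => x j) F)

section distPenalty

variable {d : ℕ} {F : Set (Fin d → ℝ)}

lemma distPenalty_mem_Icc (K : ℕ) (x : ℕ → ℝ) : distPenalty F K x ∈ Set.Icc (0 : ℝ) 1 :=
  ⟨le_min zero_le_one (mul_nonneg (Nat.cast_nonneg K) Metric.infDist_nonneg), min_le_left _ _⟩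

lemma isCylLip_distPenalty (K : ℕ) : IsCylLip d (distPenalty F K) :=
  IsCylLip.min_const (IsCylLip.const_mul ⟨1, zero_le_one, abs_infDist_sub_le F⟩ _) 1

lemma distPenalty_mono (x : ℕ → ℝ) : Monotone fun K => distPenalty F K x := fun _ _ h =>
  min_le_min le_rfl (mul_le_mul_of_nonneg_right (Nat.cast_le.2 h) Metric.infDist_nonneg)

lemma distPenalty_le_indicator (K : ℕ) (x : ℕ → ℝ) :
    distPenalty F K x ≤ Fᶜ.indicator (fun _ => (1 : ℝ)) fun j : Fin d => x j := by
  by_cases h : (fun j : Fin d => x j) ∈ F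
  · rw [Set.indicator_of_notMem (by simpa using h), distPenalty, Metric.infDist_zero_of_mem h]
    simp
  · rw [Set.indicator_of_mem h]
    exact min_le_left _ _

lemma tendsto_distPenalty (hF : IsClosed F) (hne : F.Nonempty) (x : ℕ → ℝ) :
    Tendsto (fun K => distPenalty F K x) atTop
      (𝓝 (Fᶜ.indicator (fun _ => (1 : ℝ)) fun j : Fin d => x j)) := by
  by_cases h : (fun j : Fin d => x j) ∈ F
  · rw [Set.indicator_of_notMem (by simpa using h)]
    simp [distPenalty, Metric.infDist_zero_of_mem h]
  · rw [Set.indicator_of_mem h]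
    have hpos := (hF.notMem_iff_infDist_pos hne).1 h
    refine tendsto_const_nhds.congr' ?_
    filter_upwards [(tendsto_natCast_atTop_atTop.atTop_mul_const hpos).eventually_ge_atTop 1]
      with K hK
    exact (min_eq_left hK).symm

end distPenalty

lemma measurable_head {X : ℕ → Ω → ℝ} (hX : ∀ i, X i ∈ S.H) (d : ℕ) :
    Measurable[S.sigma] (fun ω (j : Fin d) => X j ω) :=
  @measurable_pi_lambda Ω (Fin d) (fun _ => ℝ) S.sigma _ _ fun j => measurable_sigma (hX j)

/-- Borel functions of the first `d` coordinates. -/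
theorem exists_prob_clusterSet_of_measurable (hCC : S.ConditionCC Ps) (hX : S.IsIID X)
    (hmoment : S.choquet (fun ω => |X 0 ω|) < ⊤) {d : ℕ} {φlo φup : (Fin d → ℝ) → ℝ}
    (hφlo : Measurable φlo) (hφup : Measurable φup)
    (hlo : ∀ x, S.lowerMean (X 0) ≤ (φlo x : EReal)) (hle : ∀ x, φlo x ≤ φup x)
    (hup : ∀ x, (φup x : EReal) ≤ S.upperMean (X 0)) :
    ∃ P ∈ Ps, ∀ᵐ ω ∂(P : @Measure Ω S.sigma), clusterSet (runningAverage fun i => X i ω) =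
      Set.Icc (φlo fun j : Fin d => X j ω) (φup fun j : Fin d => X j ω) := by
  have hmax := subset_maxFamily hCC
  obtain ⟨P₀, hP₀⟩ := nonempty_of_conditionCC hCC
  have hm := measurable_head hX.mem d
  set p : Measure (Fin d → ℝ) :=
    @Measure.map _ _ S.sigma _ (fun ω (j : Fin d) => X j ω) (P₀ : @Measure Ω S.sigma) with hp
  have hpp : IsProbabilityMeasure p := Measure.isProbabilityMeasure_map hm.aemeasurable
  obtain ⟨lo, up, hlo', hup', -, -⟩ := exists_means hCC (hX.mem 0) hmoment
  rw [hlo'] at hlo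
  rw [hup'] at hup
  simp only [EReal.coe_le_coe_iff] at hlo hup
  have hblo : IsBdd φlo := IsBdd.of_mem_Icc fun z => ⟨hlo z, (hle z).trans (hup z)⟩
  have hbup : IsBdd φup := IsBdd.of_mem_Icc fun z => ⟨(hlo z).trans (hle z), hup z⟩
  have hhalf : ∀ k : ℕ, (0 : ℝ) < (1 / 2) ^ k := fun k => by positivity
  choose f hf hfp using fun k => exists_cylLip_lintegral_le p hφlo hblo (hhalf k)
  choose f' hf' hfp' using fun k => exists_cylLip_lintegral_le p hφup hbup (hhalf k)
  have hext := measurable_extendZero d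
  have hae := (ae_tendsto_of_lintegral_le (fun k => (hf k).measurable.comp hext) hφlo hfp).and
    (ae_tendsto_of_lintegral_le (fun k => (hf' k).measurable.comp hext) hφup hfp')
  obtain ⟨F, hF, hFne, hFp, hFt⟩ := exists_isClosed_forall p hae
  -- A Lipschitz stand-in for `∑ j, 1_{(F j)ᶜ}`, increasing to it as `K` grows.
  let H : ℕ → (ℕ → ℝ) → ℝ := fun K x => ∑ j ∈ Finset.range K, distPenalty (F j) K x
  have hH : ∀ K, IsCylLip d (H K) := fun K => IsCylLip.sum _ fun j _ => isCylLip_distPenalty K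
  have hHb : ∀ K, IsBdd (H K) := fun K =>
    IsBdd.sum _ fun j _ => IsBdd.of_mem_Icc (distPenalty_mem_Icc K)
  have hpenInt : ∀ (P : S.Prob) j K, Integrable (fun ω => distPenalty (F j) K fun i => X i ω)
      (P : @Measure Ω S.sigma) := fun P j K => integrable_Hb (S.cyl_mem_Hb
        (isCylLip_distPenalty K) (IsBdd.of_mem_Icc (distPenalty_mem_Icc K)) hX.mem) P
  have hindm : ∀ j, Measurable ((F j)ᶜ.indicator fun _ => (1 : ℝ)) := fun j =>
    measurable_const.indicator (hF j).measurableSet.compl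
  have hindInt : ∀ (P : S.Prob) j, Integrable (fun ω => (F j)ᶜ.indicator (fun _ => (1 : ℝ))
      fun i : Fin d => X i ω) (P : @Measure Ω S.sigma) := fun P j =>
    @integrable_of_bdd Ω S.sigma _ _ _ ((hindm j).comp hm)
      (IsBdd.of_mem_Icc (a := 0) (b := 1) fun ω => ⟨Set.indicator_nonneg (by simp) _,
        Set.indicator_le_self' (by simp) _⟩)
  -- The reference measure `P₀` is a witness: under it the means of the penalties are at most `(1 /
  -- 2) ^ j`.
  have hC : ∀ K, -(2 : ℝ) ≤ S.ev (fun ω => -H K fun i => X i ω) := fun K => by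
    refine le_trans ?_ (integral_le_ev (hmax hP₀)
      (S.neg_mem_Hb (S.cyl_mem_Hb (hH K) (hHb K) hX.mem)))
    rw [integral_neg, neg_le_neg_iff]
    simp only [H]
    rw [integral_finsetSum _ fun j _ => hpenInt P₀ j K]
    refine (Finset.sum_le_sum fun j _ => ?_).trans (sum_geometric_two_le K)
    refine (integral_mono (hpenInt P₀ j K) (hindInt P₀ j) fun ω =>
      distPenalty_le_indicator K _).trans ?_
    rw [← integral_map (f := (F j)ᶜ.indicator fun _ => (1 : ℝ)) hm.aemeasurable
      (hindm j).aestronglyMeasurable, ← hp,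
      integral_indicator_const _ (hF j).measurableSet.compl, smul_eq_mul, mul_one]
    exact hFp j
  obtain ⟨P, hP, hPH, hPae⟩ := exists_prob_clusterSet hCC hX hmoment hf hf' hH hHb
    (fun K x => Finset.sum_nonneg fun j _ => (distPenalty_mem_Icc K x).1)
    (fun x K K' h => (Finset.sum_le_sum fun j _ => distPenalty_mono x h).trans
      (Finset.sum_le_sum_of_subset_of_nonneg (Finset.range_mono h) fun j _ _ =>
        (distPenalty_mem_Icc K' x).1)) hC
  refine ⟨P, hP, ?_⟩
  -- Letting `K` tend to infinity bounds `∑ P((F j)ᶜ)`, so almost surely under `P` the head lies in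
  -- some `F j`, where the approximations converge.
  have hsum : ∀ J, ∑ j ∈ Finset.range J, ∫ ω, (F j)ᶜ.indicator (fun _ => (1 : ℝ))
      (fun i : Fin d => X i ω) ∂(P : @Measure Ω S.sigma) ≤ 2 + 3 := fun J => by
    have hlim : Tendsto (fun K => ∑ j ∈ Finset.range J,
        ∫ ω, distPenalty (F j) K (fun i => X i ω) ∂(P : @Measure Ω S.sigma)) atTop
        (𝓝 (∑ j ∈ Finset.range J, ∫ ω, (F j)ᶜ.indicator (fun _ => (1 : ℝ))
          (fun i : Fin d => X i ω) ∂(P : @Measure Ω S.sigma))) := by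
      refine tendsto_finsetSum _ fun j _ => tendsto_integral_of_dominated_convergence (fun _ => 1)
        (fun K => (hpenInt P j K).aestronglyMeasurable) (integrable_const _)
        (fun K => ae_of_all _ fun ω => ?_) (ae_of_all _ fun ω =>
          tendsto_distPenalty (hF j) (hFne j) fun i => X i ω)
      have h01 := distPenalty_mem_Icc (F := F j) K fun i => X i ω
      rw [Real.norm_eq_abs, abs_of_nonneg h01.1]
      exact h01.2
    refine le_of_tendsto hlim ?_
    filter_upwards [eventually_ge_atTop J] with K hK
    refine le_trans ?_ (hPH K)
    simp only [H]
    rw [integral_finsetSum _ fun j _ => hpenInt P j K]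
    exact Finset.sum_le_sum_of_subset_of_nonneg (Finset.range_mono hK) fun j _ _ =>
      integral_nonneg fun ω => (distPenalty_mem_Icc K _).1
  have hind0 : ∀ j z, 0 ≤ (F j)ᶜ.indicator (fun _ => (1 : ℝ)) z := fun j z =>
    Set.indicator_nonneg (by simp) _
  have hind : ∀ j, 0 ≤ ∫ ω, (F j)ᶜ.indicator (fun _ => (1 : ℝ))
      (fun i : Fin d => X i ω) ∂(P : @Measure Ω S.sigma) := fun j =>
    integral_nonneg fun ω => hind0 j _
  have hlim := @ae_tendsto_zero_of_sum_lintegral_le Ω S.sigma (P : @Measure Ω S.sigma)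
    (fun j ω => (F j)ᶜ.indicator (fun _ => (1 : ℝ)) fun i : Fin d => X i ω)
    (fun j => (hindm j).comp hm) (ENNReal.ofReal (2 + 3)) ENNReal.ofReal_ne_top fun K => by
      have e : ∀ j, ∫⁻ ω, ENNReal.ofReal |(F j)ᶜ.indicator (fun _ => (1 : ℝ))
          fun i : Fin d => X i ω| ∂(P : @Measure Ω S.sigma) =
          ENNReal.ofReal (∫ ω, (F j)ᶜ.indicator (fun _ => (1 : ℝ))
            (fun i : Fin d => X i ω) ∂(P : @Measure Ω S.sigma)) := fun j => by
        simp only [abs_of_nonneg (hind0 j _)]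
        exact (ofReal_integral_eq_lintegral_ofReal (hindInt P j)
          (ae_of_all _ fun ω => hind0 j _)).symm
      simp only [e]
      rw [← ENNReal.ofReal_sum_of_nonneg fun j _ => hind j]
      exact ENNReal.ofReal_le_ofReal (hsum K)
  filter_upwards [hPae, hlim] with ω hω hωF
  obtain ⟨j, hj⟩ := (hωF.eventually_lt_const zero_lt_one).exists
  have hjF : (fun i : Fin d => X i ω) ∈ F j := by
    by_contra h
    rw [Set.indicator_of_mem h] at hj
    exact lt_irrefl _ hj
  have ht := hFt j _ hjF
  have e1 : ∀ k, f k (extendZero fun i : Fin d => X i ω) = f k fun i => X i ω := fun k =>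
    (hf k).apply_extendZero fun i => X i ω
  have e2 : ∀ k, f' k (extendZero fun i : Fin d => X i ω) = f' k fun i => X i ω := fun k =>
    (hf' k).apply_extendZero fun i => X i ω
  simp only [Function.comp_def, e1, e2] at ht
  refine hω _ _ ?_ (hle _) ?_ ht.1 ht.2
  · rw [hlo', EReal.coe_le_coe_iff]; exact hlo _
  · rw [hup', EReal.coe_le_coe_iff]; exact hup _

/-- Functions in `𝕃_c` of the whole sequence. -/
theorem exists_prob_clusterSet_of_mem_Lc (hCC : S.ConditionCC Ps) (hX : S.IsIID X)
    (hmoment : S.choquet (fun ω => |X 0 ω|) < ⊤) {φlo φup : (ℕ → ℝ) → ℝ}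
    (hφlo : φlo ∈ S.Lc Ps X) (hφup : φup ∈ S.Lc Ps X)
    (hlo : ∀ x, S.lowerMean (X 0) ≤ (φlo x : EReal)) (hle : ∀ x, φlo x ≤ φup x)
    (hup : ∀ x, (φup x : EReal) ≤ S.upperMean (X 0)) :
    ∃ P ∈ Ps, ∀ᵐ ω ∂(P : @Measure Ω S.sigma), clusterSet (runningAverage fun i => X i ω) =
      Set.Icc (φlo fun i => X i ω) (φup fun i => X i ω) := by
  obtain ⟨d, f, hf, hft⟩ := exists_cylLip_tendsto hCC hX.mem hφlo
  obtain ⟨d', f', hf', hft'⟩ := exists_cylLip_tendsto hCC hX.mem hφup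
  -- Convergence holds almost surely under every member of `Ps`, so no extra penalty on the head is
  -- needed and `H = 0`.
  obtain ⟨P, hP, -, hae⟩ := exists_prob_clusterSet hCC hX hmoment hf hf' (D := 0)
    (H := fun _ _ => 0) (fun _ => IsCylLip.const 0) (fun _ => IsBdd.const 0) (fun _ _ => le_rfl)
    (fun _ => monotone_const) (C := 0) (fun _ => by simp [ev_const])
  refine ⟨P, hP, ?_⟩
  filter_upwards [hae, hft P hP, hft' P hP] with ω h h1 h2
  exact h _ _ (hlo _) (hle _) (hup _) h1 h2

end SublinearExpectation

theorem theorem2p3 {Ω : Type*} [MeasurableSpace Ω] (S : SublinearExpectation Ω)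
    (Ps : Set S.Prob) (hCC : S.ConditionCC Ps)
    (X : ℕ → Ω → ℝ) (hX : S.IsIID X) (hmoment : S.choquet (fun ω => |X 0 ω|) < ⊤) :
    (∀ (d : ℕ) (φlo φup : (Fin d → ℝ) → ℝ), Measurable φlo → Measurable φup →
      (∀ x, S.lowerMean (X 0) ≤ (φlo x : EReal)) → (∀ x, φlo x ≤ φup x) →
      (∀ x, (φup x : EReal) ≤ S.upperMean (X 0)) →
      ∃ Q ∈ S.maxFamily,
        S.outerCapacity {ω | clusterSet (runningAverage (fun i => X i ω)) =
          Set.Icc (φlo (fun j : Fin d => X j ω)) (φup (fun j : Fin d => X j ω))} = 1 ∧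
        (Q : @Measure Ω S.sigma) {ω | clusterSet (runningAverage (fun i => X i ω)) =
          Set.Icc (φlo (fun j : Fin d => X j ω)) (φup (fun j : Fin d => X j ω))} = 1) ∧
    (∀ φlo ∈ S.Lc Ps X, ∀ φup ∈ S.Lc Ps X,
      (∀ x, S.lowerMean (X 0) ≤ (φlo x : EReal)) → (∀ x, φlo x ≤ φup x) →
      (∀ x, (φup x : EReal) ≤ S.upperMean (X 0)) →
      ∃ P ∈ Ps,
        S.outerCapacity {ω | clusterSet (runningAverage (fun i => X i ω)) =
          Set.Icc (φlo (fun i => X i ω)) (φup (fun i => X i ω))} = 1 ∧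
        (P : @Measure Ω S.sigma) {ω | clusterSet (runningAverage (fun i => X i ω)) =
          Set.Icc (φlo (fun i => X i ω)) (φup (fun i => X i ω))} = 1) := by
  have hmax := SublinearExpectation.subset_maxFamily hCC
  refine ⟨fun d φlo φup hφlo hφup hlo hle hup => ?_, fun φlo hφlo φup hφup hlo hle hup => ?_⟩
  · obtain ⟨P, hP, hae⟩ := SublinearExpectation.exists_prob_clusterSet_of_measurable hCC hX
      hmoment hφlo hφup hlo hle hup
    have h1 := SublinearExpectation.measure_eq_one_of_ae hae
    exact ⟨P, hmax hP, SublinearExpectation.outerCapacity_eq_one (hmax hP) h1, h1⟩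
  · obtain ⟨P, hP, hae⟩ := SublinearExpectation.exists_prob_clusterSet_of_mem_Lc hCC hX
      hmoment hφlo hφup hlo hle hup
    have h1 := SublinearExpectation.measure_eq_one_of_ae hae
    exact ⟨P, hP, SublinearExpectation.outerCapacity_eq_one (hmax hP) h1, h1⟩
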